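/- **Setting.** Fix integers $r,v,k_0\ge 1$ and put $p=r+v$. On a probability space let $\mathbf f_t\in\mathbb R^r$ and $\boldsymbol\varepsilon_t\in\mathbb R^v$, $t\in\mathbb Z$, be square-integrable random vectors, and let $$\mathbf y_t=\mathbf L_1\mathbf f_t+\mathbf L_2\boldsymbol\varepsilon_t\in\mathbb R^p ,$$ where $\mathbf L=[\mathbf L_1,\mathbf L_2]$ is a $p\times p$ matrix of full rank. Assume $E\mathbf y_t=\mathbf 0$, $\mathrm{Cov}(\mathbf f_t)=\mathbf I_r$, $\mathrm{Cov}(\boldsymbol\varepsilon_t)=\mathbf I_v$, $\mathrm{Cov}(\boldsymbol\varepsilon_s,\boldsymbol\varepsilon_t)=\mathbf 0$ for $s\ne t$, $\mathrm{Cov}(\mathbf f_t,\boldsymbol\varepsilon_{t+j})=\mathbf 0$ for $j\ge 0$, and that $\boldsymbol\Sigma_y(k)=\mathrm{Cov}(\mathbf y_t,\mathbf y_{t-k})$ ($k\ge0$) does not depend on $t$. Let $\mathbf M=\sum_{k=1}^{k_0}\boldsymbol\Sigma_y(k)\boldsymbol\Sigma_y(k)'$ and assume that $\mathbf M$ has exactly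 $r$ nonzero eigenvalues, counted with multiplicity. Write $\mathbf L_1=\mathbf A_1\mathbf Q_1$ and $\mathbf L_2=\mathbf A_2\mathbf Q_2$ with $\mathbf A_1'\mathbf A_1=\mathbf I_r$, $\mathbf A_2'\mathbf A_2=\mathbf I_v$ ($\mathbf Q_1$, $\mathbf Q_2$ square), let $\mathbf x_t=\mathbf Q_1\mathbf f_t$, and let $\mathbf B_1\in\mathbb R^{p\times v}$, $\mathbf B_2\in\mathbb R^{p\times r}$ have orthonormal columns with $\mathbf B_1'\mathbf A_1=\mathbf 0$, $\mathbf B_2'\mathbf A_2=\mathbf 0$. **Assumption 1.** For some $\gamma>2$, $\sum_{k\ge1}\alpha(k)^{1-2/\gamma}<\infty$, where $\alpha(k)=\sup_i\sup\{|P(A\cap B)-P(A)P(B)|: A\in\mathcal F_{-\infty}^i,\ B\in\mathcal F_{i+k}^\infty\}$ and $\mathcal F_i^j$ is generated by $(\mathbf y_t,\mathbf f_t)$, $i\le t\le j$. **Assumption 2.** There are constants $C_1,C_2>0$ with $E|f_{it}|^{2\gamma}<C_1$ and $E|\varepsilon_{jt}|^{2\gamma}<C_2$ for all $i,j,t$,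 with the same $\gamma$. **Assumption 3.** $\lambda_1>\dots>\lambda_r>\lambda_{r+1}=\dots=\lambda_p=0$, where $\lambda_i$ is the $i$-th largest eigenvalue of $\mathbf M$. **Estimators.** From $\mathbf y_1,\dots,\mathbf y_n$ let $\widehat{\boldsymbol\Sigma}_y(k)=\frac1n\sum_{t=k+1}^n(\mathbf y_t-\bar{\mathbf y})(\mathbf y_{t-k}-\bar{\mathbf y})'$, where $\bar{\mathbf y}=\frac1n\sum_{t=1}^n\mathbf y_t$, and $\widehat{\mathbf M}=\sum_{k=1}^{k_0}\widehat{\boldsymbol\Sigma}_y(k)\widehat{\boldsymbol\Sigma}_y(k)'$. The columns of $\widehat{\mathbf A}_1$ are orthonormal eigenvectors of $\widehat{\mathbf M}$ for its $r$ largest eigenvalues, in decreasing order, and those of $\widehat{\mathbf B}_1$ are orthonormal eigenvectors, orthogonal to $\widehat{\mathbf A}_1$, for the remaining $v$ eigenvalues. The columns of $\widehat{\mathbf B}_2$ are orthonormal eigenvectors for the $r$ smallest eigenvalues of $\widehat{\mathbf S}=\widehat{\boldsymbol\Sigma}_y(0)\widehat{\mathbf B}_1\widehat{\mathbf B}_1'\widehat{\boldsymbol\Sigma}_y(0)$.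 The choice of eigenvectors is arbitrary. Put $\widehat{\mathbf x}_t=(\widehat{\mathbf B}_2'\widehat{\mathbf A}_1)^{-1}\widehat{\mathbf B}_2'\mathbf y_t$ (and $\widehat{\mathbf x}_t=\mathbf 0$ where the inverse does not exist). For $p\times d$ matrices with orthonormal columns let $D(\mathbf H_1,\mathbf H_2)=\sqrt{1-\frac1d\mathrm{tr}(\mathbf H_1\mathbf H_1'\mathbf H_2\mathbf H_2')}$. **Theorem 1.** Suppose Assumptions 1 and 2 hold. Then, as $n\to\infty$ ($p$ and $r$ fixed), $$D(\widehat{\mathbf A}_1,\mathbf A_1)=O_p(n^{-1/2}),\quad D(\widehat{\mathbf B}_1,\mathbf B_1)=O_p(n^{-1/2}),\quad D(\widehat{\mathbf B}_2,\mathbf B_2)=O_p(n^{-1/2}).$$ If Assumption 3 also holds and the columns of $\mathbf A_1$ are the eigenvectors of $\mathbf M$ for $\lambda_1,\dots,\lambda_r$ in this order, then, after replacing some columns of $\widehat{\mathbf A}_1$ by their negatives if necessary, $\|\widehat{\mathbf A}_1-\mathbf A_1\|_2=O_p(n^{-1/2})$ in the operator norm. Moreover (with or without Assumption 3) $\|\widehat{\mathbf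 A}_1\widehat{\mathbf x}_t-\mathbf A_1\mathbf x_t\|_2=O_p(n^{-1/2})$ for each $t$, and also when $t=t_n$ is any sequence of times that varies with $n$. -/

import Mathlib

open MeasureTheory ProbabilityTheory Filter
open scoped Matrix

noncomputable section

namespace TSFactor

/-! ### Probabilistic notions -/

/-- `X n = O_p(a n)` as `n → ∞`. -/
def IsBigOp {Ω : Type*} [MeasurableSpace Ω] (P : Measure Ω) (X : ℕ → Ω → ℝ) (a : ℕ → ℝ) : Prop :=
  ∀ δ : ℝ, 0 < δ → ∃ K : ℝ, 0 < K ∧ ∀ᶠ n in atTop, P {ω | K * a n < |X n ω|} ≤ ENNReal.ofReal δ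

/-- The σ-field generated by `Z t`, `t ≤ i`. -/
abbrev pastSigma {Ω E : Type*} [MeasurableSpace E] (Z : ℤ → Ω → E) (i : ℤ) : MeasurableSpace Ω :=
  ⨆ t : ℤ, ⨆ _ : t ≤ i, MeasurableSpace.comap (Z t) inferInstance

/-- The σ-field generated by `Z t`, `i ≤ t`. -/
abbrev futureSigma {Ω E : Type*} [MeasurableSpace E] (Z : ℤ → Ω → E) (i : ℤ) : MeasurableSpace Ω :=
  ⨆ t : ℤ, ⨆ _ : i ≤ t, MeasurableSpace.comap (Z t) inferInstance

/-- The α-mixing coefficient of the process `Z` at lag `k`: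
`sup_i sup_{A ∈ F_{-∞}^i, B ∈ F_{i+k}^∞} |P(A ∩ B) - P(A) P(B)|`. -/
def alphaMixing {Ω E : Type*} [MeasurableSpace Ω] [MeasurableSpace E] (P : Measure Ω)
    (Z : ℤ → Ω → E) (k : ℕ) : ℝ :=
  sSup {x : ℝ | ∃ (i : ℤ) (A B : Set Ω), MeasurableSet[pastSigma Z i] A ∧
    MeasurableSet[futureSigma Z (i + k)] B ∧ x = |P.real (A ∩ B) - P.real A * P.real B|}

/-- The cross-covariance matrix `Cov(X, Y)` of two random vectors. -/
def covMatrix {Ω : Type*} [MeasurableSpace Ω] (P : Measure Ω) {a b : ℕ}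
    (X : Ω → Fin a → ℝ) (Y : Ω → Fin b → ℝ) : Matrix (Fin a) (Fin b) ℝ :=
  Matrix.of fun i j => cov[fun ω => X ω i, fun ω => Y ω j; P]

/-! ### The model -/

/-- The observed process `y t = L₁ f t + L₂ ε t`. -/
def obs {Ω : Type*} {p r v : ℕ} (L₁ : Matrix (Fin p) (Fin r) ℝ) (L₂ : Matrix (Fin p) (Fin v) ℝ)
    (f : ℤ → Ω → Fin r → ℝ) (ε : ℤ → Ω → Fin v → ℝ) (t : ℤ) (ω : Ω) : Fin p → ℝ :=
  L₁ *ᵥ f t ω + L₂ *ᵥ ε t ω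

/-- The second-order latent structure `y t = L₁ f t + L₂ ε t` with `L = [L₁, L₂]` of full rank `p`
(it is used with `r + v = p`, so `L` is square), `ε` a white noise, standardized `f` and `ε`,
and `f t` uncorrelated with the present and future noise. -/
structure IsFactorModel {Ω : Type*} [MeasurableSpace Ω] (P : Measure Ω) {p r v : ℕ}
    (L₁ : Matrix (Fin p) (Fin r) ℝ) (L₂ : Matrix (Fin p) (Fin v) ℝ)
    (f : ℤ → Ω → Fin r → ℝ) (ε : ℤ → Ω → Fin v → ℝ) : Prop where
  measurable_f : ∀ t, Measurable (f t)
  measurable_ε : ∀ t, Measurable (ε t)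
  memLp_f : ∀ t i, MemLp (fun ω => f t ω i) 2 P
  memLp_ε : ∀ t j, MemLp (fun ω => ε t ω j) 2 P
  full_rank : (Matrix.fromCols L₁ L₂).rank = p
  mean_obs : ∀ t i, ∫ ω, obs L₁ L₂ f ε t ω i ∂P = 0
  cov_f : ∀ t, covMatrix P (f t) (f t) = 1
  cov_ε : ∀ t, covMatrix P (ε t) (ε t) = 1
  white_noise : ∀ s t, s ≠ t → covMatrix P (ε s) (ε t) = 0
  cov_f_ε : ∀ (t : ℤ) (j : ℕ), covMatrix P (f t) (ε (t + j)) = 0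
  /-- `Cov(y t, y (t - k))` does not depend on `t`. -/
  stationary : ∀ (t : ℤ) (k : ℕ), covMatrix P (obs L₁ L₂ f ε t) (obs L₁ L₂ f ε (t - k)) =
    covMatrix P (obs L₁ L₂ f ε 0) (obs L₁ L₂ f ε (0 - k))

/-- The lag-`k` autocovariance matrix `Σ_y(k) = Cov(y t, y (t - k))` of a process whose
autocovariances do not depend on `t`. -/
def autocov {Ω : Type*} [MeasurableSpace Ω] (P : Measure Ω) {p : ℕ}
    (y : ℤ → Ω → Fin p → ℝ) (k : ℕ) : Matrix (Fin p) (Fin p) ℝ :=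
  covMatrix P (y 0) (y (0 - k))

/-- `∑_{k=1}^{k₀} Γ(k) Γ(k)ᵀ`: this is `M` for `Γ = Σ_y`, and its estimator for the sample
autocovariances. -/
def lagSum {p : ℕ} (Γ : ℕ → Matrix (Fin p) (Fin p) ℝ) (k₀ : ℕ) : Matrix (Fin p) (Fin p) ℝ :=
  ∑ k ∈ Finset.Icc 1 k₀, Γ k * (Γ k)ᵀ

theorem lagSum_isHermitian {p : ℕ} (Γ : ℕ → Matrix (Fin p) (Fin p) ℝ) (k₀ : ℕ) :
    (lagSum Γ k₀).IsHermitian := by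
  unfold lagSum Matrix.IsHermitian
  rw [Matrix.conjTranspose_sum]
  refine Finset.sum_congr rfl fun k _ => ?_
  simp [Matrix.conjTranspose_eq_transpose_of_trivial, Matrix.transpose_mul]

/-- The `r` largest eigenvalues `λ₁ > ... > λ_r` of `S` are distinct and positive, and the
remaining ones vanish (`eigenvalues₀` lists the eigenvalues in decreasing order, from index `0`). -/
def HasDistinctEigenvalues {p : ℕ} {S : Matrix (Fin p) (Fin p) ℝ} (hS : S.IsHermitian)
    (r : ℕ) : Prop :=
  (∀ i j : Fin (Fintype.card (Fin p)), i < j → (i : ℕ) < r → hS.eigenvalues₀ j < hS.eigenvalues₀ i) ∧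
  (∀ i : Fin (Fintype.card (Fin p)), (i : ℕ) < r → 0 < hS.eigenvalues₀ i) ∧
  (∀ i : Fin (Fintype.card (Fin p)), r ≤ (i : ℕ) → hS.eigenvalues₀ i = 0)

/-! ### The estimators -/

/-- The sample mean of `y 1, ..., y n`. -/
def sampleMean {p : ℕ} (y : ℤ → Fin p → ℝ) (n : ℕ) : Fin p → ℝ :=
  (n : ℝ)⁻¹ • ∑ t ∈ Finset.Icc 1 n, y (t : ℤ)

/-- The lag-`k` sample autocovariance matrix
`n⁻¹ ∑_{t=k+1}^n (y t - ȳ) (y (t-k) - ȳ)ᵀ` of `y 1, ..., y n`. -/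
def sampleAutocov {p : ℕ} (y : ℤ → Fin p → ℝ) (n k : ℕ) : Matrix (Fin p) (Fin p) ℝ :=
  (n : ℝ)⁻¹ • ∑ t ∈ Finset.Icc (k + 1) n,
    Matrix.vecMulVec (y (t : ℤ) - sampleMean y n) (y ((t : ℤ) - (k : ℤ)) - sampleMean y n)

/-- `[U, W]` is an orthonormal eigenbasis of the symmetric matrix `S`; the columns of `U` belong to
the `a` largest eigenvalues, in decreasing order, and those of `W` to the `b` smallest ones. -/
def IsSpectralSplit {p a b : ℕ} (S : Matrix (Fin p) (Fin p) ℝ) (U : Matrix (Fin p) (Fin a) ℝ)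
    (W : Matrix (Fin p) (Fin b) ℝ) : Prop :=
  a + b = p ∧ Uᵀ * U = 1 ∧ Wᵀ * W = 1 ∧ Uᵀ * W = 0 ∧
  ∃ (lam : Fin a → ℝ) (mu : Fin b → ℝ), S * U = U * Matrix.diagonal lam ∧
    S * W = W * Matrix.diagonal mu ∧ Antitone lam ∧ ∀ i j, mu j ≤ lam i

/-- The matrix `Σ B Bᵀ Σ` of the projected principal component analysis. -/
def projPCA {p v : ℕ} (S : Matrix (Fin p) (Fin p) ℝ) (B : Matrix (Fin p) (Fin v) ℝ) :
    Matrix (Fin p) (Fin p) ℝ :=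
  S * B * Bᵀ * S

/-- The recovered factor `(B₂ᵀ A₁)⁻¹ B₂ᵀ y`. -/
def recoveredFactor {p r : ℕ} (A₁ B₂ : Matrix (Fin p) (Fin r) ℝ) (y : Fin p → ℝ) : Fin r → ℝ :=
  (B₂ᵀ * A₁)⁻¹ *ᵥ (B₂ᵀ *ᵥ y)

/-- The discrepancy `D(H₁, H₂) = √(1 - tr(H₁ H₁ᵀ H₂ H₂ᵀ) / d)` between the column spaces of two
half orthonormal `p × d` matrices. -/
def discrepancy {p d : ℕ} (H₁ H₂ : Matrix (Fin p) (Fin d) ℝ) : ℝ :=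
  Real.sqrt (1 - 1 / (d : ℝ) * (H₁ * H₁ᵀ * (H₂ * H₂ᵀ)).trace)

open scoped Matrix.Norms.L2Operator in
/-- The spectral norm of a matrix (the operator norm between Euclidean spaces). -/
def matNorm₂ {p d : ℕ} (A : Matrix (Fin p) (Fin d) ℝ) : ℝ := ‖A‖

/-- The Euclidean norm of a vector. -/
def vecNorm₂ {p : ℕ} (u : Fin p → ℝ) : ℝ := Real.sqrt (∑ i, u i ^ 2)

end TSFactor

end

open TSFactor

/-! The proof separates a stochastic estimate, the `n^(-1/2)` rate of the sample autocovariance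
matrices, from deterministic Lipschitz bounds that carry this rate to the estimators.

Stochastic part. Up to products of sample means, an entry of the sample autocovariance is an average
of `y_{t,i} y_{t-k,j}`. Moments of order `2γ` of `y` give moments of order `γ` of these products, so
Davydov's inequality (`abs_covariance_le_of_mixing`) bounds their covariances by a multiple of
`α^(1-2/γ)` at the lag. These are summable, so the average has variance `O(1/n)` and Chebyshev
applies (`IsLocalFunctional.isBigOp_average_sub`).

Identification. For `k ≥ 1` the noise at time `t` is uncorrelated with `y_{t-k}`, so the columns of
`Σ_y(k)` lie in the span of `A₁`; as `M` has rank `r`, this span is its range. Since `B₁ᵀ A₁ = 0`,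
`Σ_y(0) B₁ = L₂ L₂ᵀ B₁`, so the matrix of the second step has the span of `A₂` as its range and that
of `B₂` as its kernel.

Spectral perturbation. A leading eigenprojection maximizes `tr (S Q)` over projections `Q` of its
rank, and a spectral gap makes this maximum quadratically sharp. Comparing the maximizers for `S`
and `S'` gives a Davis–Kahan bound (`HasGap.norm_sub_le`) that does not depend on the choice of
eigenvectors. Applied to every initial group of eigenvectors, it controls the individual
eigenvectors up to sign.

Common component. `Â₁ x̂_t` is an oblique projection of `y_t` that depends only on the two estimated
spans. It is Lipschitz in them near the population pair (`exists_norm_obliqueProj_sub_le`), and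
`y_t` is bounded in probability uniformly in `t`. -/

namespace TSFactor

/-! ### Orthogonal projections, trace maximization and spectral gaps -/

section Projections

open scoped Matrix.Norms.Frobenius

variable {m n ι : Type*} [Fintype m] [Fintype n] [Fintype ι]

lemma frobenius_sq_eq_sum (A : Matrix m n ℝ) : ‖A‖ ^ 2 = ∑ i, ∑ j, A i j ^ 2 := by
  have h : 0 ≤ ∑ i, ∑ j, A i j ^ 2 :=
    Finset.sum_nonneg fun i _ => Finset.sum_nonneg fun j _ => sq_nonneg _
  rw [Matrix.frobenius_norm_def]
  simp only [Real.rpow_two, Real.norm_eq_abs, sq_abs]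
  rw [← Real.sqrt_eq_rpow, Real.sq_sqrt h]

lemma trace_transpose_mul_eq_sum (A B : Matrix m n ℝ) :
    (Aᵀ * B).trace = ∑ i, ∑ j, A i j * B i j := by
  simp only [Matrix.trace, Matrix.diag, Matrix.mul_apply, Matrix.transpose_apply]
  exact Finset.sum_comm

lemma trace_transpose_mul_self (A : Matrix m n ℝ) : (Aᵀ * A).trace = ‖A‖ ^ 2 := by
  rw [trace_transpose_mul_eq_sum, frobenius_sq_eq_sum]
  simp only [pow_two]

lemma abs_trace_transpose_mul_le (A B : Matrix m n ℝ) : |(Aᵀ * B).trace| ≤ ‖A‖ * ‖B‖ := by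
  apply abs_le_of_sq_le_sq _ (by positivity)
  rw [mul_pow, frobenius_sq_eq_sum, frobenius_sq_eq_sum, trace_transpose_mul_eq_sum]
  simp only [← Fintype.sum_prod_type']
  exact Finset.sum_mul_sq_le_sq_mul_sq _ _ _

lemma frobenius_norm_le_sum_abs (A : Matrix m n ℝ) : ‖A‖ ≤ ∑ i, ∑ j, |A i j| := by
  refine abs_le_of_sq_le_sq' ?_ (Finset.sum_nonneg fun i _ => Finset.sum_nonneg fun j _ =>
    abs_nonneg _) |>.2
  rw [frobenius_sq_eq_sum]
  simp only [← Fintype.sum_prod_type']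
  refine le_trans (le_of_eq ?_) (Finset.sum_sq_le_sq_sum_of_nonneg fun x _ => abs_nonneg _)
  simp

/-- Symmetric idempotent matrices. -/
structure IsOrthProj (Q : Matrix m m ℝ) : Prop where
  symm : Qᵀ = Q
  idem : Q * Q = Q

namespace IsOrthProj

variable {P Q : Matrix m m ℝ}

lemma one_sub [DecidableEq m] (hQ : IsOrthProj Q) : IsOrthProj (1 - Q) where
  symm := by simp [hQ.symm]
  idem := by simp [sub_mul, mul_sub, hQ.idem]

lemma trace_eq (hQ : IsOrthProj Q) : Q.trace = ‖Q‖ ^ 2 := by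
  rw [← trace_transpose_mul_self, hQ.symm, hQ.idem]

/-- For projections of equal trace the deficit `tr P - tr (P Q)` is half the squared distance, so
the inequality in `HasGap` is quadratic growth around the maximizer. -/
lemma norm_sub_sq (hP : IsOrthProj P) (hQ : IsOrthProj Q) :
    ‖Q - P‖ ^ 2 = P.trace + Q.trace - 2 * (P * Q).trace := by
  rw [← trace_transpose_mul_self, Matrix.transpose_sub, hP.symm, hQ.symm]
  simp only [sub_mul, mul_sub, hP.idem, hQ.idem, Matrix.trace_sub, Matrix.trace_mul_comm Q P]
  ring

lemma diag_nonneg {n : Type*} (hQ : IsOrthProj Q) (C : Matrix m n ℝ) (i : n) : 0 ≤ (Cᵀ * Q * C) i i := by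
  have : Cᵀ * Q * C = (Q * C)ᵀ * (Q * C) := by
    rw [Matrix.transpose_mul, hQ.symm, Matrix.mul_assoc, Matrix.mul_assoc, ← Matrix.mul_assoc Q Q,
      hQ.idem]
  rw [this, Matrix.mul_apply]
  exact Finset.sum_nonneg fun j _ => mul_self_nonneg _

end IsOrthProj

/-- The projection `P` maximizes `tr (S Q)` over the projections `Q` of the same rank, with
curvature `δ`. -/
def HasGap (S P : Matrix m m ℝ) (δ : ℝ) : Prop :=
  ∀ Q, IsOrthProj Q → Q.trace = P.trace →
    δ * (P.trace - (P * Q).trace) ≤ (S * P).trace - (S * Q).trace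

/-- Adding the optimality inequalities of `P` for `S` and of `P'` for `S'` gives `δ/2 ‖P' - P‖² ≤ tr
((S' - S)(P' - P))`; Cauchy–Schwarz then cancels one factor. Only `S` needs a positive gap, so ties
among the estimated eigenvalues are harmless. -/
lemma HasGap.norm_sub_le {S S' P P' : Matrix m m ℝ} {δ : ℝ} (hδ : 0 < δ) (hP : IsOrthProj P)
    (hP' : IsOrthProj P') (htr : P'.trace = P.trace) (hS : S'ᵀ - Sᵀ = S' - S)
    (h : HasGap S P δ) (h' : HasGap S' P' 0) : ‖P' - P‖ ≤ 2 / δ * ‖S' - S‖ := by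
  have h1 := h P' hP' htr
  have h2 := h' P hP htr.symm
  have h3 := (le_abs_self _).trans (abs_trace_transpose_mul_le (S' - S) (P' - P))
  rw [Matrix.transpose_sub, hS] at h3
  simp only [sub_mul, mul_sub, Matrix.trace_sub] at h3
  have h4 := hP.norm_sub_sq hP'
  rw [htr] at h4
  have h5 : δ / 2 * ‖P' - P‖ ^ 2 ≤ ‖S' - S‖ * ‖P' - P‖ := by
    rw [h4]; linarith
  rcases (norm_nonneg (P' - P)).eq_or_lt with h0 | h0
  · rw [← h0]; positivity
  · have : δ / 2 * ‖P' - P‖ ≤ ‖S' - S‖ := by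
      refine le_of_mul_le_mul_right ?_ h0
      linarith
    rw [div_mul_eq_mul_div, le_div_iff₀ hδ]
    linarith

open scoped MatrixOrder Matrix.Norms.L2Operator in
lemma exists_eq_transpose_mul_self [DecidableEq m] {S : Matrix m m ℝ} (hS : S.PosSemidef) :
    ∃ R : Matrix m m ℝ, S = Rᵀ * R := by
  obtain ⟨R, hR⟩ := CStarAlgebra.nonneg_iff_eq_star_mul_self.1 hS.nonneg
  exact ⟨R, by rw [hR, Matrix.star_eq_conjTranspose, Matrix.conjTranspose_eq_transpose_of_trivial]⟩

/-- A positive semidefinite matrix with a left pseudo-inverse has a spectral gap above its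
kernel. -/
lemma exists_hasGap_of_posSemidef [DecidableEq m] {S P J : Matrix m m ℝ} (hS : S.PosSemidef)
    (hP : IsOrthProj P) (hSP : S * P = S) (hJ : J * S = P) : ∃ δ, 0 < δ ∧ HasGap S P δ := by
  obtain ⟨R, hR⟩ := exists_eq_transpose_mul_self hS
  -- With `S = Rᵀ R` the two sides of the gap inequality are governed by `‖P (1 - Q)‖²` and `‖R (1 -
  -- Q)‖²`, and `P = (J Rᵀ) R`. The `+ 1` makes `K` positive.
  set K := ‖J * Rᵀ‖ ^ 2 + 1 with hK
  have hK0 : 0 < K := by positivity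
  refine ⟨K⁻¹, inv_pos.2 hK0, fun Q hQ htr => ?_⟩
  have e1 : P.trace - (P * Q).trace = ‖P * (1 - Q)‖ ^ 2 := by
    rw [← trace_transpose_mul_self, Matrix.transpose_mul, hQ.one_sub.symm, hP.symm,
      Matrix.mul_assoc, ← Matrix.mul_assoc P P, hP.idem, Matrix.trace_mul_comm (1 - Q), Matrix.mul_assoc,
      hQ.one_sub.idem, mul_sub, mul_one, Matrix.trace_sub]
  have e2 : (S * P).trace - (S * Q).trace = ‖R * (1 - Q)‖ ^ 2 := by
    rw [← trace_transpose_mul_self, Matrix.transpose_mul, hQ.one_sub.symm,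
      Matrix.mul_assoc, ← Matrix.mul_assoc Rᵀ R, ← hR, Matrix.trace_mul_comm (1 - Q), Matrix.mul_assoc,
      hQ.one_sub.idem, mul_sub, mul_one, Matrix.trace_sub, hSP]
  have e3 : ‖P * (1 - Q)‖ ≤ ‖J * Rᵀ‖ * ‖R * (1 - Q)‖ := by
    have : P * (1 - Q) = (J * Rᵀ) * (R * (1 - Q)) := by
      rw [← hJ, hR]; simp only [Matrix.mul_assoc]
    rw [this]
    exact Matrix.frobenius_norm_mul _ _
  rw [e1, e2, inv_mul_le_iff₀ hK0]
  calc ‖P * (1 - Q)‖ ^ 2 ≤ (‖J * Rᵀ‖ * ‖R * (1 - Q)‖) ^ 2 := by gcongr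
    _ = ‖J * Rᵀ‖ ^ 2 * ‖R * (1 - Q)‖ ^ 2 := by ring
    _ ≤ K * ‖R * (1 - Q)‖ ^ 2 := by gcongr; linarith

/-- The projection onto the span of the columns `T` of `O`. -/
def spanProj [DecidableEq ι] (O : Matrix m ι ℝ) (T : Finset ι) : Matrix m m ℝ :=
  O * Matrix.diagonal (fun i => if i ∈ T then (1 : ℝ) else 0) * Oᵀ

lemma exists_separating (T : Finset ι) (l : ι → ℝ) (h : ∀ i ∈ T, ∀ j ∉ T, l j ≤ l i) :
    ∃ c, (∀ i ∈ T, c ≤ l i) ∧ ∀ j ∉ T, l j ≤ c := by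
  rcases T.eq_empty_or_nonempty with rfl | hT
  · exact ⟨∑ j, |l j|, by simp, fun j _ => (le_abs_self _).trans
      (Finset.single_le_sum (f := fun j => |l j|) (fun _ _ => abs_nonneg _) (Finset.mem_univ j))⟩
  · obtain ⟨i, hi, hmin⟩ := T.exists_min_image l hT
    exact ⟨l i, hmin, fun j hj => h i hi j hj⟩

/-- The threshold is the largest value off `T` and `δ` the distance to the smallest value on `T`;
when either side is empty, any positive `δ` will do. -/
lemma exists_strict_separating (T : Finset ι) (l : ι → ℝ) (h : ∀ i ∈ T, ∀ j ∉ T, l j < l i) :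
    ∃ c δ, 0 < δ ∧ (∀ i ∈ T, c + δ ≤ l i) ∧ ∀ j ∉ T, l j ≤ c := by
  classical
  rcases Tᶜ.eq_empty_or_nonempty with hT | hT
  · obtain ⟨c, hc, -⟩ := exists_separating T l fun i hi j hj => (h i hi j hj).le
    refine ⟨c - 1, 1, one_pos, fun i hi => by linarith [hc i hi], fun j hj => ?_⟩
    rw [← Finset.mem_compl, hT] at hj
    simp at hj
  · obtain ⟨j, hj, hmax⟩ := Tᶜ.exists_max_image l hT
    rcases T.eq_empty_or_nonempty with rfl | hT'
    · exact ⟨l j, 1, one_pos, by simp, fun k hk => hmax k (Finset.mem_compl.2 hk)⟩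
    · obtain ⟨i, hi, hmin⟩ := T.exists_min_image l hT'
      exact ⟨l j, l i - l j, sub_pos.2 (h i hi j (Finset.mem_compl.1 hj)),
        fun k hk => by linarith [hmin k hk], fun k hk => hmax k (Finset.mem_compl.2 hk)⟩

section Eigenbasis

variable [DecidableEq ι] {O : Matrix m ι ℝ} {T : Finset ι}

lemma spanProj_isOrthProj (hO : Oᵀ * O = 1) : IsOrthProj (spanProj O T) where
  symm := by simp [spanProj, Matrix.transpose_mul, Matrix.mul_assoc]
  idem := by
    have : ∀ D : Matrix ι ι ℝ, O * D * Oᵀ * (O * D * Oᵀ) = O * (D * D) * Oᵀ := fun D => by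
      rw [show O * D * Oᵀ * (O * D * Oᵀ) = O * D * (Oᵀ * O) * (D * Oᵀ) by
        simp only [Matrix.mul_assoc], hO]
      simp only [Matrix.mul_assoc, Matrix.mul_one]
    rw [spanProj, this, Matrix.diagonal_mul_diagonal]
    congr 3
    ext i
    split_ifs <;> simp

lemma trace_spanProj_mul (Q : Matrix m m ℝ) :
    (spanProj O T * Q).trace = ∑ i ∈ T, (Oᵀ * Q * O) i i := by
  rw [spanProj, Matrix.mul_assoc, Matrix.mul_assoc, Matrix.trace_mul_comm, Matrix.mul_assoc,
    Matrix.trace]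
  simp [Matrix.diagonal_mul]

variable [DecidableEq m]

lemma trace_spanProj (hO : Oᵀ * O = 1) : (spanProj O T).trace = T.card := by
  rw [← mul_one (spanProj O T), trace_spanProj_mul, Matrix.mul_one, hO]
  simp

/-- In the eigenbasis `tr (S Q) = ∑ lᵢ wᵢ` with weights `wᵢ = (Oᵀ Q O)ᵢᵢ` in `[0, 1]` of total
`|T|`. Weight missing on `T` reappears outside, and each unit moved loses at least `c + δ` and
regains at most `c`. -/
lemma spanProj_hasGap (hO : Oᵀ * O = 1) (hO' : O * Oᵀ = 1) {S : Matrix m m ℝ} {l : ι → ℝ}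
    (hS : S * O = O * Matrix.diagonal l) {c δ : ℝ} (hT : ∀ i ∈ T, c + δ ≤ l i)
    (hT' : ∀ i ∉ T, l i ≤ c) : HasGap S (spanProj O T) δ := by
  intro Q hQ htr
  have hSd : S = O * Matrix.diagonal l * Oᵀ := by
    rw [← hS, Matrix.mul_assoc, hO', Matrix.mul_one]
  have key : ∀ Q : Matrix m m ℝ, (S * Q).trace = ∑ i, l i * (Oᵀ * Q * O) i i := fun Q => by
    rw [hSd, Matrix.mul_assoc, Matrix.mul_assoc, Matrix.trace_mul_comm, Matrix.mul_assoc,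
      Matrix.trace]
    simp [Matrix.diagonal_mul]
  have hw0 := fun i => hQ.diag_nonneg O i
  have hw1 : ∀ i, (Oᵀ * Q * O) i i ≤ 1 := fun i => by
    have := hQ.one_sub.diag_nonneg O i
    rw [Matrix.mul_sub, Matrix.sub_mul, Matrix.mul_one, hO] at this
    simpa using this
  have hsum : ∑ i, (Oᵀ * Q * O) i i = T.card := by
    rw [← trace_spanProj hO, ← htr]
    change (Oᵀ * Q * O).trace = _
    rw [Matrix.trace_mul_comm, ← Matrix.mul_assoc, hO', Matrix.one_mul]
  have hP : (S * spanProj O T).trace = ∑ i ∈ T, l i := by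
    rw [Matrix.trace_mul_comm, trace_spanProj_mul, Matrix.mul_assoc, hS, ← Matrix.mul_assoc, hO]
    simp
  rw [hP, key, trace_spanProj hO, trace_spanProj_mul]
  generalize hw : (fun i => (Oᵀ * Q * O) i i) = w at *
  simp only [funext_iff] at hw
  simp only [hw] at *
  have hs2 := Finset.sum_add_sum_compl T w
  have hs3 := Finset.sum_add_sum_compl T (fun i => l i * w i)
  have a1 : ∑ i ∈ T, (c + δ) * (1 - w i) ≤ ∑ i ∈ T, l i * (1 - w i) :=
    Finset.sum_le_sum fun i hi => mul_le_mul_of_nonneg_right (hT i hi) (by linarith [hw1 i])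
  have a2 : ∑ i ∈ Tᶜ, l i * w i ≤ ∑ i ∈ Tᶜ, c * w i :=
    Finset.sum_le_sum fun i hi =>
      mul_le_mul_of_nonneg_right (hT' i (Finset.mem_compl.1 hi)) (hw0 i)
  rw [← Finset.mul_sum] at a1 a2
  simp only [mul_sub, mul_one, Finset.sum_sub_distrib, Finset.sum_const, nsmul_eq_mul] at a1
  -- The weight outside `T` equals the weight missing on `T`, which is the trace deficit of `Q`.
  have : ∑ i ∈ Tᶜ, w i = T.card - ∑ i ∈ T, w i := by linarith
  rw [this] at a2
  nlinarith

end Eigenbasis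

end Projections

/-! ### Eigenvector splits, prefix projections and single eigenvectors -/

section Splits

open scoped Matrix.Norms.Frobenius

lemma orthonormal_fromCols {p a b : ℕ} (hab : a + b = p) {U : Matrix (Fin p) (Fin a) ℝ}
    {W : Matrix (Fin p) (Fin b) ℝ} (hU : Uᵀ * U = 1) (hW : Wᵀ * W = 1) (hUW : Uᵀ * W = 0) :
    (Matrix.fromCols U W)ᵀ * Matrix.fromCols U W = 1 ∧
      Matrix.fromCols U W * (Matrix.fromCols U W)ᵀ = 1 := by
  have h : (Matrix.fromCols U W)ᵀ * Matrix.fromCols U W = 1 := by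
    have hWU : Wᵀ * U = 0 := by
      rw [← Matrix.transpose_transpose (Wᵀ * U), Matrix.transpose_mul, Matrix.transpose_transpose,
        hUW, Matrix.transpose_zero]
    rw [Matrix.transpose_fromCols, Matrix.fromRows_mul_fromCols, hU, hW, hUW, hWU,
      Matrix.fromBlocks_one]
  exact ⟨h, (Matrix.mul_eq_one_comm_of_equiv (finSumFinEquiv.trans (finCongr hab))).1 h⟩

lemma mul_transpose_add_mul_transpose {p a b : ℕ} (hab : a + b = p) {U : Matrix (Fin p) (Fin a) ℝ}
    {W : Matrix (Fin p) (Fin b) ℝ} (hU : Uᵀ * U = 1) (hW : Wᵀ * W = 1) (hUW : Uᵀ * W = 0) :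
    U * Uᵀ + W * Wᵀ = 1 := by
  rw [← (orthonormal_fromCols hab hU hW hUW).2, Matrix.transpose_fromCols,
    Matrix.fromCols_mul_fromRows]

section

variable {m n : Type*} [Fintype m] [Fintype n] [DecidableEq n]

lemma isOrthProj_mul_transpose {H : Matrix m n ℝ} (hH : Hᵀ * H = 1) : IsOrthProj (H * Hᵀ) where
  symm := by simp
  idem := by
    rw [Matrix.mul_assoc, ← Matrix.mul_assoc Hᵀ, hH, Matrix.one_mul]

lemma trace_mul_transpose {H : Matrix m n ℝ} (hH : Hᵀ * H = 1) :
    (H * Hᵀ).trace = Fintype.card n := by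
  rw [Matrix.trace_mul_comm, hH, Matrix.trace_one]

end

/-- The radicand is exactly the squared Frobenius distance of the two projections divided by `2 d`.
-/
lemma discrepancy_le {p d : ℕ} (hd : 0 < d) {H₁ H₂ : Matrix (Fin p) (Fin d) ℝ}
    (h₁ : H₁ᵀ * H₁ = 1) (h₂ : H₂ᵀ * H₂ = 1) :
    |discrepancy H₁ H₂| ≤ ‖H₁ * H₁ᵀ - H₂ * H₂ᵀ‖ := by
  have hd' : (1 : ℝ) ≤ d := by exact_mod_cast hd
  have hsq := (isOrthProj_mul_transpose h₂).norm_sub_sq (isOrthProj_mul_transpose h₁)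
  rw [discrepancy, abs_of_nonneg (Real.sqrt_nonneg _), Real.sqrt_le_left (norm_nonneg _)]
  have hnn := sq_nonneg ‖H₁ * H₁ᵀ - H₂ * H₂ᵀ‖
  rw [trace_mul_transpose h₁, trace_mul_transpose h₂, Fintype.card_fin,
    Matrix.trace_mul_comm (H₂ * H₂ᵀ)] at hsq
  rw [hsq] at hnn ⊢
  generalize (H₁ * H₁ᵀ * (H₂ * H₂ᵀ)).trace = t at *
  have : (d : ℝ) + d - 2 * t = 2 * d * (1 - 1 / d * t) := by field_simp; ring
  rw [this] at hnn ⊢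
  have h0 : 0 ≤ 1 - 1 / d * t := nonneg_of_mul_nonneg_right hnn (by positivity)
  nlinarith

/-- The first `k` indices of the left summand. -/
def leftPrefix (a b k : ℕ) : Finset (Fin a ⊕ Fin b) :=
  Finset.univ.filter fun x => Sum.elim (fun i : Fin a => decide ((i : ℕ) < k)) (fun _ => false) x = true

lemma inl_mem_leftPrefix {a b k : ℕ} (i : Fin a) : Sum.inl i ∈ leftPrefix a b k ↔ (i : ℕ) < k := by
  simp [leftPrefix]

lemma inr_notMem_leftPrefix {a b k : ℕ} (j : Fin b) : Sum.inr j ∉ leftPrefix a b k := by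
  simp [leftPrefix]

lemma spanProj_leftPrefix_apply {p a b : ℕ} (U : Matrix (Fin p) (Fin a) ℝ)
    (W : Matrix (Fin p) (Fin b) ℝ) (k : ℕ) (i j : Fin p) :
    spanProj (Matrix.fromCols U W) (leftPrefix a b k) i j =
      ∑ x : Fin a, if (x : ℕ) < k then U i x * U j x else 0 := by
  rw [spanProj, Matrix.mul_apply]
  simp only [Matrix.mul_diagonal, Matrix.transpose_apply,
    Fintype.sum_sum_type, inl_mem_leftPrefix, inr_notMem_leftPrefix, Matrix.fromCols_apply_inl,
    if_false, mul_zero, zero_mul, Finset.sum_const_zero, add_zero]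
  exact Finset.sum_congr rfl fun x _ => by split_ifs <;> simp

lemma spanProj_leftPrefix_full {p a b : ℕ} (U : Matrix (Fin p) (Fin a) ℝ)
    (W : Matrix (Fin p) (Fin b) ℝ) :
    spanProj (Matrix.fromCols U W) (leftPrefix a b a) = U * Uᵀ := by
  ext i j
  rw [spanProj_leftPrefix_apply]
  simp [Matrix.mul_apply]

/-- The rank-one projection onto the `k`-th eigenvector is a difference of consecutive prefix
projections, so bounds for the prefixes suffice for single eigenvectors. -/
lemma spanProj_leftPrefix_succ {p a b : ℕ} (U : Matrix (Fin p) (Fin a) ℝ)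
    (W : Matrix (Fin p) (Fin b) ℝ) (k : Fin a) :
    spanProj (Matrix.fromCols U W) (leftPrefix a b (k + 1)) -
      spanProj (Matrix.fromCols U W) (leftPrefix a b k) =
        Matrix.vecMulVec (fun i => U i k) (fun i => U i k) := by
  ext i j
  rw [Matrix.sub_apply, spanProj_leftPrefix_apply, spanProj_leftPrefix_apply,
    ← Finset.sum_sub_distrib, Finset.sum_eq_single k, Matrix.vecMulVec_apply]
  · simp
  · intro x _ hx
    have : (x : ℕ) ≠ k := fun h => hx (Fin.ext h)
    have : (x : ℕ) < k + 1 ↔ (x : ℕ) < k := by omega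
    simp [this]
  · simp

variable {p a b : ℕ} {S : Matrix (Fin p) (Fin p) ℝ} {U : Matrix (Fin p) (Fin a) ℝ}
  {W : Matrix (Fin p) (Fin b) ℝ}

lemma mul_fromCols_eq_mul_diagonal {lam : Fin a → ℝ} {mu : Fin b → ℝ}
    (hU : S * U = U * Matrix.diagonal lam) (hW : S * W = W * Matrix.diagonal mu) :
    S * Matrix.fromCols U W = Matrix.fromCols U W * Matrix.diagonal (Sum.elim lam mu) := by
  ext i (j | j)
  · have := congr_fun₂ hU i j
    simpa [Matrix.mul_apply, Matrix.diagonal_apply] using this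
  · have := congr_fun₂ hW i j
    simpa [Matrix.mul_apply, Matrix.diagonal_apply] using this

namespace IsSpectralSplit

lemma fromCols_orthonormal (h : IsSpectralSplit S U W) :
    (Matrix.fromCols U W)ᵀ * Matrix.fromCols U W = 1 ∧
      Matrix.fromCols U W * (Matrix.fromCols U W)ᵀ = 1 :=
  orthonormal_fromCols h.1 h.2.1 h.2.2.1 h.2.2.2.1

lemma add_eq_one (h : IsSpectralSplit S U W) : U * Uᵀ + W * Wᵀ = 1 :=
  mul_transpose_add_mul_transpose h.1 h.2.1 h.2.2.1 h.2.2.2.1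

/-- Sample eigenvalues may coincide, so curvature `0`, that is bare optimality, is all that is
available here. -/
lemma hasGap_leftPrefix (h : IsSpectralSplit S U W) (k : ℕ) :
    HasGap S (spanProj (Matrix.fromCols U W) (leftPrefix a b k)) 0 := by
  obtain ⟨-, -, -, -, lam, mu, h1, h2, h3, h4⟩ := id h
  obtain ⟨c, hc, hc'⟩ := exists_separating (leftPrefix a b k) (Sum.elim lam mu) (by
    rintro (i | i) hi (j | j) hj
    · rw [inl_mem_leftPrefix] at hi hj
      exact h3 (Fin.le_def.2 (by omega))
    · exact h4 i j
    · exact absurd hi (inr_notMem_leftPrefix _)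
    · exact absurd hi (inr_notMem_leftPrefix _))
  exact spanProj_hasGap h.fromCols_orthonormal.1 h.fromCols_orthonormal.2
    (mul_fromCols_eq_mul_diagonal h1 h2) (by simpa using hc) hc'

lemma hasGap (h : IsSpectralSplit S U W) : HasGap S (U * Uᵀ) 0 := by
  rw [← spanProj_leftPrefix_full U W]
  exact h.hasGap_leftPrefix a

end IsSpectralSplit

lemma exists_hasGap_leftPrefix (hab : a + b = p) (hU : Uᵀ * U = 1) (hW : Wᵀ * W = 1)
    (hUW : Uᵀ * W = 0) {lam : Fin a → ℝ} {mu : Fin b → ℝ}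
    (h1 : S * U = U * Matrix.diagonal lam) (h2 : S * W = W * Matrix.diagonal mu)
    (h3 : StrictAnti lam) (h4 : ∀ i j, mu j < lam i) (k : ℕ) :
    ∃ δ, 0 < δ ∧ HasGap S (spanProj (Matrix.fromCols U W) (leftPrefix a b k)) δ := by
  obtain ⟨c, δ, hδ, hc, hc'⟩ := exists_strict_separating (leftPrefix a b k) (Sum.elim lam mu) (by
    rintro (i | i) hi (j | j) hj
    · rw [inl_mem_leftPrefix] at hi hj
      exact h3 (Fin.lt_def.2 (by omega))
    · exact h4 i j
    · exact absurd hi (inr_notMem_leftPrefix _)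
    · exact absurd hi (inr_notMem_leftPrefix _))
  obtain ⟨hO, hO'⟩ := orthonormal_fromCols hab hU hW hUW
  exact ⟨δ, hδ, spanProj_hasGap hO hO' (mul_fromCols_eq_mul_diagonal h1 h2) hc hc'⟩

/-- Up to the sign, a unit vector is controlled by the projection onto it. -/
lemma sum_sq_sign_sub_le {m : Type*} [Fintype m] (u w : m → ℝ)
    (hu : u ⬝ᵥ u = 1) (hw : w ⬝ᵥ w = 1) :
    ∑ i, ((if 0 ≤ u ⬝ᵥ w then 1 else -1) * u i - w i) ^ 2 ≤
      ‖Matrix.vecMulVec u u - Matrix.vecMulVec w w‖ ^ 2 := by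
  have hproj : ∀ u : m → ℝ, u ⬝ᵥ u = 1 → IsOrthProj (Matrix.vecMulVec u u) := fun u hu =>
    { symm := by ext i j; simp [Matrix.vecMulVec_apply, mul_comm]
      idem := by rw [Matrix.vecMulVec_mul_vecMulVec, hu]; simp }
  have htr : ∀ u : m → ℝ, u ⬝ᵥ u = 1 → (Matrix.vecMulVec u u).trace = 1 := fun u hu => by
    rw [Matrix.trace_vecMulVec, hu]
  have hc : (u ⬝ᵥ w) ^ 2 ≤ 1 := by
    have := Finset.sum_mul_sq_le_sq_mul_sq Finset.univ u w
    simp only [dotProduct] at hu hw ⊢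
    simp only [← pow_two] at hu hw
    rwa [hu, hw, one_mul] at this
  have e : ∀ s : ℝ, s ^ 2 = 1 → ∑ i, (s * u i - w i) ^ 2 = 2 - 2 * (s * (u ⬝ᵥ w)) := fun s hs => by
    have : ∀ i, (s * u i - w i) ^ 2 = s ^ 2 * (u i * u i) + w i * w i - 2 * (s * (u i * w i)) :=
      fun i => by ring
    simp only [this, Finset.sum_sub_distrib, Finset.sum_add_distrib, ← Finset.mul_sum]
    simp only [dotProduct] at hu hw ⊢
    rw [hu, hw, hs]; ring
  rw [(hproj w hw).norm_sub_sq (hproj u hu), htr u hu, htr w hw, Matrix.vecMulVec_mul_vecMulVec,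
    e _ (by split_ifs <;> norm_num)]
  have e2 : (Matrix.vecMulVec w ((w ⬝ᵥ u) • u)).trace = (u ⬝ᵥ w) ^ 2 := by
    rw [Matrix.trace_vecMulVec, dotProduct_smul, dotProduct_comm w u, smul_eq_mul, pow_two]
  rw [e2]
  -- With `c = u ⬝ᵥ w` the two sides are `2 - 2|c|` and `2 - 2c²`, and `c² ≤ |c|` because `|c| ≤ 1`.
  split_ifs with h
  · nlinarith
  · nlinarith

end Splits

/-! ### Norm comparison and pseudo-inverses -/

lemma sum_mulVec_sq_le {m n : Type*} [Fintype m] [Fintype n] (A : Matrix m n ℝ) (u : n → ℝ) :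
    ∑ i, (A *ᵥ u) i ^ 2 ≤ (∑ i, ∑ j, A i j ^ 2) * ∑ j, u j ^ 2 := by
  rw [Finset.sum_mul]
  exact Finset.sum_le_sum fun i _ => Finset.sum_mul_sq_le_sq_mul_sq _ _ _

open scoped Matrix.Norms.L2Operator in
lemma matNorm₂_nonneg {p d : ℕ} (A : Matrix (Fin p) (Fin d) ℝ) : 0 ≤ matNorm₂ A :=
  norm_nonneg A

open scoped Matrix.Norms.L2Operator in
lemma matNorm₂_le_sqrt {p d : ℕ} (A : Matrix (Fin p) (Fin d) ℝ) :
    matNorm₂ A ≤ Real.sqrt (∑ i, ∑ j, A i j ^ 2) := by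
  rw [matNorm₂, Matrix.l2_opNorm_def]
  refine ContinuousLinearMap.opNorm_le_bound _ (Real.sqrt_nonneg _) fun x => ?_
  have h0 : 0 ≤ ∑ i, ∑ j, A i j ^ 2 :=
    Finset.sum_nonneg fun i _ => Finset.sum_nonneg fun j _ => sq_nonneg _
  rw [EuclideanSpace.norm_eq, EuclideanSpace.norm_eq]
  simp only [Real.norm_eq_abs, sq_abs]
  refine (Real.sqrt_le_sqrt (sum_mulVec_sq_le A x.ofLp)).trans_eq ?_
  exact Real.sqrt_mul h0 _

lemma exists_right_inverse_of_rank {m n : Type*} [Fintype m] [Fintype n] [DecidableEq m]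
    [DecidableEq n] (A : Matrix m n ℝ) (h : A.rank = Fintype.card m) :
    ∃ X : Matrix n m ℝ, A * X = 1 := by
  rw [← Matrix.mulVec_surjective_iff_exists_right_inverse]
  have : LinearMap.range A.mulVecLin = ⊤ :=
    Submodule.eq_top_of_finrank_eq (by rw [← Matrix.rank, h, Module.finrank_fintype_fun_eq_card])
  exact LinearMap.range_eq_top.1 this

/-- A symmetric matrix of rank `r` whose range lies in the span of `r` orthonormal vectors has a
left pseudo-inverse. -/
lemma exists_mul_eq_of_rank {p r : ℕ} {M : Matrix (Fin p) (Fin p) ℝ} {A : Matrix (Fin p) (Fin r) ℝ}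
    (hM : Mᵀ = M) (hA : A * Aᵀ * M = M) (hr : M.rank = r) :
    ∃ J : Matrix (Fin p) (Fin p) ℝ, J * M = A * Aᵀ := by
  have h1 : (Aᵀ * M).rank = Fintype.card (Fin r) := by
    refine le_antisymm (Matrix.rank_le_card_height _) ?_
    rw [Fintype.card_fin]
    calc r = (A * (Aᵀ * M)).rank := by rw [← Matrix.mul_assoc, hA, hr]
      _ ≤ _ := Matrix.rank_mul_le_right _ _
  obtain ⟨X, hX⟩ := exists_right_inverse_of_rank _ h1
  -- From `Aᵀ M X = 1` and `A Aᵀ M = M` comes `M X = A`; by symmetry of `M`, `Xᵀ M = Aᵀ`.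
  refine ⟨A * Xᵀ, ?_⟩
  have : M * X = A := by
    rw [← hA, Matrix.mul_assoc, Matrix.mul_assoc, ← Matrix.mul_assoc Aᵀ, hX, Matrix.mul_one]
  rw [Matrix.mul_assoc]
  nth_rw 3 [← this]
  rw [Matrix.transpose_mul, hM]

/-! ### Lipschitz bounds for eigenspaces and eigenvectors -/

section

open scoped Matrix.Norms.Frobenius

variable {p a b : ℕ}

lemma lagSum_posSemidef (Γ : ℕ → Matrix (Fin p) (Fin p) ℝ) (k₀ : ℕ) :
    (lagSum Γ k₀).PosSemidef :=
  Matrix.posSemidef_sum _ fun k _ => by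
    have := Matrix.posSemidef_self_mul_conjTranspose (Γ k)
    rwa [Matrix.conjTranspose_eq_transpose_of_trivial] at this

lemma projPCA_eq {S : Matrix (Fin p) (Fin p) ℝ} (hS : Sᵀ = S) (B : Matrix (Fin p) (Fin b) ℝ) :
    projPCA S B = S * B * (S * B)ᵀ := by
  rw [projPCA, Matrix.transpose_mul, hS, Matrix.mul_assoc, Matrix.mul_assoc]

lemma projPCA_posSemidef {S : Matrix (Fin p) (Fin p) ℝ} (hS : Sᵀ = S)
    (B : Matrix (Fin p) (Fin b) ℝ) : (projPCA S B).PosSemidef := by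
  have := Matrix.posSemidef_self_mul_conjTranspose (S * B)
  rwa [Matrix.conjTranspose_eq_transpose_of_trivial, ← projPCA_eq hS] at this

/-- The spectral gap of `S`, given a left pseudo-inverse, controls the estimated projection. -/
lemma exists_norm_sub_le_of_posSemidef {S J : Matrix (Fin p) (Fin p) ℝ}
    {A : Matrix (Fin p) (Fin a) ℝ} (hS : S.PosSemidef) (hA : Aᵀ * A = 1)
    (hAS : A * Aᵀ * S = S) (hJ : J * S = A * Aᵀ) :
    ∃ C, 0 < C ∧ ∀ (b : ℕ) (S' : Matrix (Fin p) (Fin p) ℝ) (U : Matrix (Fin p) (Fin a) ℝ)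
      (W : Matrix (Fin p) (Fin b) ℝ), S'ᵀ = S' → IsSpectralSplit S' U W →
      ‖U * Uᵀ - A * Aᵀ‖ ≤ C * ‖S' - S‖ := by
  have hSt : Sᵀ = S := by
    rw [← Matrix.conjTranspose_eq_transpose_of_trivial]; exact hS.1
  have hP := isOrthProj_mul_transpose hA
  obtain ⟨δ, hδ, hgap⟩ := exists_hasGap_of_posSemidef hS hP
    (by rw [← hSt, ← hP.symm, ← Matrix.transpose_mul, hAS]) hJ
  refine ⟨2 / δ, by positivity, fun b S' U W hS' h => ?_⟩
  refine hgap.norm_sub_le hδ hP (isOrthProj_mul_transpose h.2.1) ?_ (by rw [hS', hSt]) h.hasGap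
  rw [trace_mul_transpose hA, trace_mul_transpose h.2.1]

/-- Complementary projections have the same error: this passes from `Â₁` to `B̂₁`, and from the
leading eigenvectors of the second step to `B̂₂`. -/
lemma norm_compl_sub_eq {U U' : Matrix (Fin p) (Fin a) ℝ} {W W' : Matrix (Fin p) (Fin b) ℝ}
    (h : U * Uᵀ + W * Wᵀ = 1) (h' : U' * U'ᵀ + W' * W'ᵀ = 1) :
    ‖W * Wᵀ - W' * W'ᵀ‖ = ‖U * Uᵀ - U' * U'ᵀ‖ := by
  rw [eq_sub_of_add_eq' h, eq_sub_of_add_eq' h', ← norm_neg]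
  congr 1
  abel

/-- Up to signs, the leading eigenvectors of a matrix with distinct leading eigenvalues are
Lipschitz functions of the matrix. -/
lemma exists_matNorm₂_sub_le {S : Matrix (Fin p) (Fin p) ℝ} {A : Matrix (Fin p) (Fin a) ℝ}
    {B : Matrix (Fin p) (Fin b) ℝ} (hSt : Sᵀ = S) (hab : a + b = p) (hA : Aᵀ * A = 1)
    (hB : Bᵀ * B = 1) (hAB : Aᵀ * B = 0) {lam : Fin a → ℝ} {mu : Fin b → ℝ}
    (h1 : S * A = A * Matrix.diagonal lam) (h2 : S * B = B * Matrix.diagonal mu)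
    (h3 : StrictAnti lam) (h4 : ∀ i j, mu j < lam i) :
    ∃ C, 0 < C ∧ ∀ (S' : Matrix (Fin p) (Fin p) ℝ) (U : Matrix (Fin p) (Fin a) ℝ)
      (W : Matrix (Fin p) (Fin b) ℝ), S'ᵀ = S' → IsSpectralSplit S' U W →
      matNorm₂ (U * Matrix.diagonal (fun j =>
        if 0 ≤ (fun i => U i j) ⬝ᵥ (fun i => A i j) then (1 : ℝ) else -1) - A) ≤ C * ‖S' - S‖ := by
  choose δ hδ hgap using exists_hasGap_leftPrefix hab hA hB hAB h1 h2 h3 h4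
  obtain ⟨hO, hO'⟩ := orthonormal_fromCols hab hA hB hAB
  have hC : 0 ≤ ∑ j : Fin a, (2 / δ (j + 1) + 2 / δ j) := Finset.sum_nonneg fun j _ => by
    have := hδ (j + 1); have := hδ j; positivity
  -- Column `j` is a difference of the prefix projections `j + 1` and `j`, and pays for both gaps;
  -- the `1 +` keeps the constant positive.
  refine ⟨1 + ∑ j : Fin a, (2 / δ (j + 1) + 2 / δ j), by positivity, fun S' U W hS' h => ?_⟩
  have hpre : ∀ k : ℕ, ‖spanProj (Matrix.fromCols U W) (leftPrefix a b k) -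
      spanProj (Matrix.fromCols A B) (leftPrefix a b k)‖ ≤ 2 / δ k * ‖S' - S‖ := fun k =>
    (hgap k).norm_sub_le (hδ k) (spanProj_isOrthProj hO)
      (spanProj_isOrthProj h.fromCols_orthonormal.1)
      (by rw [trace_spanProj hO, trace_spanProj h.fromCols_orthonormal.1]) (by rw [hS', hSt])
      (h.hasGap_leftPrefix k)
  have hcol : ∀ j : Fin a, ‖Matrix.vecMulVec (fun i => U i j) (fun i => U i j) -
      Matrix.vecMulVec (fun i => A i j) (fun i => A i j)‖ ≤
        (2 / δ (j + 1) + 2 / δ j) * ‖S' - S‖ := fun j => by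
    rw [← spanProj_leftPrefix_succ U W j, ← spanProj_leftPrefix_succ A B j, sub_sub_sub_comm,
      add_mul]
    exact (norm_sub_le _ _).trans (add_le_add (hpre _) (hpre _))
  have hunit : ∀ V : Matrix (Fin p) (Fin a) ℝ, Vᵀ * V = 1 → ∀ j,
      (fun i => V i j) ⬝ᵥ (fun i => V i j) = 1 := fun V hV j => by
    simpa [Matrix.mul_apply, dotProduct] using congr_fun₂ hV j j
  refine (matNorm₂_le_sqrt _).trans ?_
  rw [Real.sqrt_le_left (by positivity), Finset.sum_comm]
  calc _ ≤ ∑ j, ‖Matrix.vecMulVec (fun i => U i j) (fun i => U i j) -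
      Matrix.vecMulVec (fun i => A i j) (fun i => A i j)‖ ^ 2 := by
        refine Finset.sum_le_sum fun j _ => ?_
        refine le_trans (le_of_eq ?_) (sum_sq_sign_sub_le _ _ (hunit U h.2.1 j) (hunit A hA j))
        refine Finset.sum_congr rfl fun x _ => ?_
        rw [Matrix.sub_apply, Matrix.mul_diagonal, mul_comm]
    _ ≤ (∑ j, ‖Matrix.vecMulVec (fun i => U i j) (fun i => U i j) -
      Matrix.vecMulVec (fun i => A i j) (fun i => A i j)‖) ^ 2 :=
        Finset.sum_sq_le_sq_sum_of_nonneg fun _ _ => norm_nonneg _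
    _ ≤ _ := by
        gcongr
        refine (Finset.sum_le_sum fun j _ => hcol j).trans ?_
        rw [← Finset.sum_mul]
        gcongr
        linarith

/-- Eigenvalues of an orthonormal eigenbasis, as roots of the characteristic polynomial. -/
lemma roots_charpoly_eq_of_split {S : Matrix (Fin p) (Fin p) ℝ} {A : Matrix (Fin p) (Fin a) ℝ}
    {B : Matrix (Fin p) (Fin b) ℝ} (hab : a + b = p) (hA : Aᵀ * A = 1)
    (hB : Bᵀ * B = 1) (hAB : Aᵀ * B = 0) {lam : Fin a → ℝ} {mu : Fin b → ℝ}
    (h1 : S * A = A * Matrix.diagonal lam) (h2 : S * B = B * Matrix.diagonal mu) :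
    S.charpoly.roots = Finset.univ.val.map (Sum.elim lam mu) := by
  obtain ⟨hO, hO'⟩ := orthonormal_fromCols hab hA hB hAB
  have hS := mul_fromCols_eq_mul_diagonal h1 h2
  have e : S = (Matrix.fromCols A B * Matrix.diagonal (Sum.elim lam mu)) *
      (Matrix.fromCols A B)ᵀ := by
    rw [← hS, Matrix.mul_assoc, hO', Matrix.mul_one]
  have e2 : S.charpoly = (Matrix.diagonal (Sum.elim lam mu)).charpoly := by
    have := Matrix.charpoly_mul_comm' (Matrix.fromCols A B * Matrix.diagonal (Sum.elim lam mu))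
      (Matrix.fromCols A B)ᵀ
    rw [← e, ← Matrix.mul_assoc, hO, Matrix.one_mul] at this
    simp only [Fintype.card_sum, Fintype.card_fin, hab] at this
    -- Both sides carry a power of `X` given by the size of the other index type; these sizes agree,
    -- so the powers cancel.
    exact mul_left_cancel₀ (pow_ne_zero _ Polynomial.X_ne_zero) this
  rw [e2, Matrix.charpoly_diagonal, Polynomial.roots_prod]
  · simp
  · simp [Finset.prod_ne_zero_iff, Polynomial.X_sub_C_ne_zero]

/-- A repeated `lam i` would be a root of the characteristic polynomial of multiplicity at least
two, whereas a nonzero value occurs at most once in the list `eigenvalues₀`. -/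
lemma HasDistinctEigenvalues.strictAnti {S : Matrix (Fin p) (Fin p) ℝ} {A : Matrix (Fin p) (Fin a) ℝ}
    {B : Matrix (Fin p) (Fin b) ℝ} {hS : S.IsHermitian} {r : ℕ} (hd : HasDistinctEigenvalues hS r)
    (hab : a + b = p) (hA : Aᵀ * A = 1)
    (hB : Bᵀ * B = 1) (hAB : Aᵀ * B = 0) {lam : Fin a → ℝ} {mu : Fin b → ℝ}
    (h1 : S * A = A * Matrix.diagonal lam) (h2 : S * B = B * Matrix.diagonal mu)
    (hanti : Antitone lam) (h0 : ∀ i, lam i ≠ 0) : StrictAnti lam := by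
  refine hanti.strictAnti_of_injective fun i j hij => ?_
  by_contra hne
  have hroots := roots_charpoly_eq_of_split hab hA hB hAB h1 h2
  have hroots' := hS.roots_charpoly_eq_eigenvalues₀
  have c1 : 2 ≤ Multiset.count (lam i) S.charpoly.roots := by
    rw [hroots, Multiset.count_map]
    have : ({Sum.inl i, Sum.inl j} : Finset (Fin a ⊕ Fin b)).card ≤
        (Finset.univ.filter fun x => lam i = Sum.elim lam mu x).card := by
      refine Finset.card_le_card fun x hx => ?_
      simp only [Finset.mem_insert, Finset.mem_singleton] at hx
      rcases hx with rfl | rfl <;> simp [hij]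
    rwa [Finset.card_pair (by simpa using hne)] at this
  rw [hroots', Multiset.count_map] at c1
  have : 1 < (Finset.univ.filter fun x => lam i = hS.eigenvalues₀ x).card := c1
  obtain ⟨x, hx, y, hy, hxy⟩ := Finset.one_lt_card.1 this
  simp only [Finset.mem_filter, Finset.mem_univ, true_and] at hx hy
  have key : ∀ x y, lam i = hS.eigenvalues₀ x → lam i = hS.eigenvalues₀ y → ¬ x < y := by
    intro x y hx hy hlt
    by_cases hxr : (x : ℕ) < r
    · exact absurd (hd.1 x y hlt hxr) (by rw [← hx, ← hy]; exact lt_irrefl _)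
    · exact h0 i (by rw [hx, hd.2.2 x (not_lt.1 hxr)])
  rcases lt_or_gt_of_ne hxy with h | h
  · exact key x y hx hy h
  · exact key y x hy hx h

end

/-! ### Oblique projections as functions of two subspaces -/

section Oblique

open scoped Matrix.Norms.Frobenius

variable {p r v : ℕ}

/-- The projection onto the span of `A` along the orthogonal complement of the span of `B`. -/
noncomputable def obliqueProj (A B : Matrix (Fin p) (Fin r) ℝ) : Matrix (Fin p) (Fin p) ℝ :=
  A * (Bᵀ * A)⁻¹ * Bᵀ

/-- The oblique projection is unchanged when `A` or `B` is multiplied on the right by an invertible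
matrix, so the choice of eigenvectors drops out of the estimated common component. -/
lemma mulVec_recoveredFactor (A B : Matrix (Fin p) (Fin r) ℝ) (y : Fin p → ℝ) :
    A *ᵥ recoveredFactor A B y = obliqueProj A B *ᵥ y := by
  rw [recoveredFactor, obliqueProj, Matrix.mulVec_mulVec, Matrix.mulVec_mulVec]

/-- For projections `P`, `R`, the matrix `R P + (1 - R) (1 - P)`, which maps the range of `P` to
that of `R` and similarly for the complements. -/
def transferMatrix (P R : Matrix (Fin p) (Fin p) ℝ) : Matrix (Fin p) (Fin p) ℝ :=
  R * P + (1 - R) * (1 - P)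

lemma transpose_mul_transferMatrix {A B : Matrix (Fin p) (Fin r) ℝ} (hB : Bᵀ * B = 1) :
    Bᵀ * transferMatrix (A * Aᵀ) (B * Bᵀ) = Bᵀ * A * Aᵀ := by
  have h1 : Bᵀ * (B * Bᵀ) = Bᵀ := by rw [← Matrix.mul_assoc, hB, Matrix.one_mul]
  have h2 : Bᵀ * (1 - B * Bᵀ) = 0 := by rw [Matrix.mul_sub, h1, Matrix.mul_one, sub_self]
  rw [transferMatrix, Matrix.mul_add, ← Matrix.mul_assoc _ (B * Bᵀ), ← Matrix.mul_assoc _ (1 - B * Bᵀ),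
    h1, h2, Matrix.zero_mul, add_zero, ← Matrix.mul_assoc]

/-- Once the transfer matrix is inverted, this expresses the oblique projection through `A Aᵀ` and
`B Bᵀ` alone, which are the quantities with known rates. -/
lemma obliqueProj_mul_transferMatrix {A B : Matrix (Fin p) (Fin r) ℝ} (hB : Bᵀ * B = 1)
    (hu : IsUnit (Bᵀ * A).det) :
    obliqueProj A B * transferMatrix (A * Aᵀ) (B * Bᵀ) = A * Aᵀ := by
  rw [obliqueProj, Matrix.mul_assoc, transpose_mul_transferMatrix hB, Matrix.mul_assoc,
    ← Matrix.mul_assoc _ (Bᵀ * A), Matrix.nonsing_inv_mul _ hu, Matrix.one_mul]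

lemma norm_transferMatrix_sub_le {P R P' R' : Matrix (Fin p) (Fin p) ℝ} {c : ℝ} (hP' : ‖P'‖ ≤ c)
    (hR : ‖R‖ ≤ c) :
    ‖transferMatrix P' R' - transferMatrix P R‖ ≤ (2 * c + 1) * (‖P' - P‖ + ‖R' - R‖) := by
  -- The transfer matrix equals `2 R P - R - P + 1`.
  have e : transferMatrix P' R' - transferMatrix P R =
      (2 : ℝ) • ((R' - R) * P') + (2 : ℝ) • (R * (P' - P)) - (R' - R) - (P' - P) := by
    simp only [transferMatrix, mul_sub, sub_mul, mul_one, one_mul, two_smul]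
    abel
  have h1 := Matrix.frobenius_norm_mul (R' - R) P'
  have h2 := Matrix.frobenius_norm_mul R (P' - P)
  have h3 : ‖R' - R‖ * ‖P'‖ ≤ ‖R' - R‖ * c := by gcongr
  have h4 : ‖R‖ * ‖P' - P‖ ≤ c * ‖P' - P‖ := by gcongr
  rw [e]
  calc _ ≤ ‖(2 : ℝ) • ((R' - R) * P')‖ + ‖(2 : ℝ) • (R * (P' - P))‖ + ‖R' - R‖ + ‖P' - P‖ :=
        (norm_sub_le _ _).trans <| add_le_add_left ((norm_sub_le _ _).trans <|
          add_le_add_left (norm_add_le _ _) _) _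
    _ ≤ _ := by
        rw [norm_smul, norm_smul, Real.norm_ofNat]
        linarith

/-- The norm is `√r`; the cruder integer bound avoids the root. -/
lemma norm_mul_transpose_le {A : Matrix (Fin p) (Fin r) ℝ} (hA : Aᵀ * A = 1) :
    ‖A * Aᵀ‖ ≤ r := by
  have h := (isOrthProj_mul_transpose hA).trace_eq
  rw [trace_mul_transpose hA, Fintype.card_fin] at h
  have : (r : ℝ) ≤ (r : ℝ) ^ 2 := by exact_mod_cast Nat.le_self_pow two_ne_zero r
  exact abs_le_of_sq_le_sq' (by rw [← h]; exact this) (by positivity) |>.2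

/-- The transfer matrix sends the span of `A₁` to that of `B₂` through `B₂ᵀ A₁`, and the span of
`B₁` to that of `A₂` through `A₂ᵀ B₁`; the left inverse is assembled from the inverses of these two
blocks. -/
lemma exists_mul_transferMatrix_eq_one {A₁ B₂ : Matrix (Fin p) (Fin r) ℝ}
    {A₂ B₁ : Matrix (Fin p) (Fin v) ℝ} (hB₂ : B₂ᵀ * B₂ = 1) (h₁ : A₁ * A₁ᵀ + B₁ * B₁ᵀ = 1)
    (h₂ : B₂ * B₂ᵀ + A₂ * A₂ᵀ = 1) (hA₂ : A₂ᵀ * A₂ = 1) (hA₂B₂ : A₂ᵀ * B₂ = 0)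
    {G : Matrix (Fin r) (Fin r) ℝ} (hG : G * (B₂ᵀ * A₁) = 1)
    {H : Matrix (Fin v) (Fin v) ℝ} (hH : H * (A₂ᵀ * B₁) = 1) :
    ∃ J, J * transferMatrix (A₁ * A₁ᵀ) (B₂ * B₂ᵀ) = 1 := by
  refine ⟨A₁ * G * B₂ᵀ + B₁ * H * A₂ᵀ, ?_⟩
  have e : A₂ᵀ * transferMatrix (A₁ * A₁ᵀ) (B₂ * B₂ᵀ) = A₂ᵀ * B₁ * B₁ᵀ := by
    rw [transferMatrix, ← eq_sub_of_add_eq' h₁, ← eq_sub_of_add_eq' h₂, Matrix.mul_add]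
    simp only [← Matrix.mul_assoc, hA₂B₂, hA₂, Matrix.zero_mul, Matrix.one_mul, zero_add]
  rw [Matrix.add_mul, Matrix.mul_assoc, transpose_mul_transferMatrix hB₂, Matrix.mul_assoc (B₁ * H),
    e, ← h₁, Matrix.mul_assoc, ← Matrix.mul_assoc G, hG, Matrix.mul_assoc B₁, ← Matrix.mul_assoc H,
    hH, Matrix.one_mul, Matrix.one_mul]

/-- Near a nondegenerate pair of subspaces, the oblique projection is a Lipschitz function of
the orthogonal projections. -/
lemma exists_norm_obliqueProj_sub_le {A B : Matrix (Fin p) (Fin r) ℝ} (hB : Bᵀ * B = 1)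
    (hu : IsUnit (Bᵀ * A).det) {J : Matrix (Fin p) (Fin p) ℝ}
    (hJ : J * transferMatrix (A * Aᵀ) (B * Bᵀ) = 1) :
    ∃ c C, 0 < c ∧ 0 < C ∧ ∀ A' B' : Matrix (Fin p) (Fin r) ℝ, A'ᵀ * A' = 1 → B'ᵀ * B' = 1 →
      ‖A' * A'ᵀ - A * Aᵀ‖ + ‖B' * B'ᵀ - B * Bᵀ‖ ≤ c →
      ‖obliqueProj A' B' - obliqueProj A B‖ ≤
        C * (‖A' * A'ᵀ - A * Aᵀ‖ + ‖B' * B'ᵀ - B * Bᵀ‖) := by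
  set T := transferMatrix (A * Aᵀ) (B * Bᵀ) with hT
  set D : ℝ := 2 * r + 1 with hD
  have hD0 : 0 < D := by positivity
  -- The radius is chosen so that `‖J‖ ‖T' - T‖ ≤ 1/2`; the factor `2` in the Lipschitz constant
  -- comes from absorbing `½ ‖X‖` below.
  refine ⟨1 / (2 * (‖J‖ + 1) * D), 2 * (‖J‖ + 1) * (1 + ‖obliqueProj A B‖ * D), by positivity,
    by positivity, fun A' B' hA' hB' he => ?_⟩
  set e := ‖A' * A'ᵀ - A * Aᵀ‖ + ‖B' * B'ᵀ - B * Bᵀ‖ with hedef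
  set T' := transferMatrix (A' * A'ᵀ) (B' * B'ᵀ) with hT'
  have hTT : ‖T' - T‖ ≤ D * e :=
    norm_transferMatrix_sub_le (norm_mul_transpose_le hA') (norm_mul_transpose_le hB)
  have hsmall : ‖J‖ * ‖T' - T‖ ≤ 1 / 2 := by
    have h1 : (‖J‖ + 1) * (D * e) ≤ 1 / 2 := by
      rw [le_div_iff₀ (by positivity)] at he
      linarith
    calc ‖J‖ * ‖T' - T‖ ≤ (‖J‖ + 1) * (D * e) := by gcongr; linarith
      _ ≤ 1 / 2 := h1
  -- A kernel vector `x` gives `z = A' x` with `T' z = 0`, hence `z = -J (T' - T) z` and `‖z‖ ≤ ½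
  -- ‖z‖`. Writing `z` as a one-column matrix allows the use of the Frobenius norm.
  have hu' : IsUnit (B'ᵀ * A').det := by
    rw [← Matrix.isUnit_iff_isUnit_det, ← Matrix.mulVec_injective_iff_isUnit]
    refine (injective_iff_map_eq_zero (B'ᵀ * A').mulVecLin).2 fun x hx => ?_
    rw [Matrix.mulVecLin_apply] at hx
    set z : Matrix (Fin p) Unit ℝ := Matrix.of fun i _ => (A' *ᵥ x) i with hz
    have hz' : z = A' * Matrix.replicateCol Unit x := by
      ext i j; simp [hz, Matrix.mul_apply, Matrix.mulVec, dotProduct]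
    have hBz : B'ᵀ * z = 0 := by
      ext i j
      rw [hz', ← Matrix.mul_assoc]
      simpa [Matrix.mul_apply, Matrix.mulVec, dotProduct] using congr_fun hx i
    have hPz : A' * A'ᵀ * z = z := by
      rw [hz', Matrix.mul_assoc, ← Matrix.mul_assoc A'ᵀ, hA', Matrix.one_mul]
    have hTz : T' * z = 0 := by
      rw [hT', transferMatrix, Matrix.add_mul, Matrix.mul_assoc, hPz, Matrix.mul_assoc,
        Matrix.mul_assoc (1 - B' * B'ᵀ), Matrix.sub_mul 1 (A' * A'ᵀ), hPz, hBz, Matrix.one_mul,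
        sub_self, Matrix.mul_zero, Matrix.mul_zero, add_zero]
    have hzz : z = -(J * ((T' - T) * z)) := by
      rw [Matrix.sub_mul, hTz, zero_sub, Matrix.mul_neg, neg_neg, ← Matrix.mul_assoc, hJ,
        Matrix.one_mul]
    have hn : ‖z‖ ≤ 1 / 2 * ‖z‖ := by
      calc ‖z‖ = ‖J * ((T' - T) * z)‖ := by
            conv_lhs => rw [hzz, norm_neg]
        _ ≤ ‖J‖ * (‖T' - T‖ * ‖z‖) := (Matrix.frobenius_norm_mul _ _).trans (by
            gcongr; exact Matrix.frobenius_norm_mul _ _)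
        _ = ‖J‖ * ‖T' - T‖ * ‖z‖ := by ring
        _ ≤ 1 / 2 * ‖z‖ := by gcongr
    have hz0 : z = 0 := norm_eq_zero.1 (le_antisymm (by linarith) (norm_nonneg z))
    have hAx : A' *ᵥ x = 0 := by
      ext i; exact congr_fun₂ hz0 i ()
    rw [← Matrix.one_mulVec x, ← hA', ← Matrix.mulVec_mulVec, hAx, Matrix.mulVec_zero]
  have e1 : obliqueProj A B * T = A * Aᵀ := obliqueProj_mul_transferMatrix hB hu
  have e2 : obliqueProj A' B' * T' = A' * A'ᵀ := obliqueProj_mul_transferMatrix hB' hu'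
  set X := obliqueProj A' B' - obliqueProj A B with hX
  -- The unknown `X` also appears on the right, but multiplied by the small `T' - T`, so it can be
  -- absorbed after multiplication by `J`.
  have e3 : X * T = (A' * A'ᵀ - A * Aᵀ) - obliqueProj A B * (T' - T) - X * (T' - T) := by
    rw [← e1, ← e2, hX]
    simp only [Matrix.sub_mul, Matrix.mul_sub]
    abel
  have e4 : X = ((A' * A'ᵀ - A * Aᵀ) - obliqueProj A B * (T' - T) - X * (T' - T)) * J := by
    rw [← e3, Matrix.mul_assoc, mul_eq_one_comm.1 hJ, Matrix.mul_one]
  have e5 : ‖X‖ ≤ (e + ‖obliqueProj A B‖ * (D * e)) * ‖J‖ + 1 / 2 * ‖X‖ := by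
    calc ‖X‖ ≤ ‖(A' * A'ᵀ - A * Aᵀ) - obliqueProj A B * (T' - T) - X * (T' - T)‖ * ‖J‖ := by
          conv_lhs => rw [e4]
          exact Matrix.frobenius_norm_mul _ _
      _ ≤ (e + ‖obliqueProj A B‖ * (D * e) + ‖X‖ * ‖T' - T‖) * ‖J‖ := by
          gcongr
          refine (norm_sub_le _ _).trans (add_le_add ((norm_sub_le _ _).trans (add_le_add ?_ ?_))
            (Matrix.frobenius_norm_mul _ _))
          · rw [hedef]; linarith [norm_nonneg (B' * B'ᵀ - B * Bᵀ)]
          · exact (Matrix.frobenius_norm_mul _ _).trans (by gcongr)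
      _ = (e + ‖obliqueProj A B‖ * (D * e)) * ‖J‖ + ‖J‖ * ‖T' - T‖ * ‖X‖ := by ring
      _ ≤ _ := by gcongr
  have he0 : 0 ≤ e := by positivity
  calc ‖X‖ ≤ 2 * ((e + ‖obliqueProj A B‖ * (D * e)) * ‖J‖) := by linarith
    _ ≤ 2 * ((e + ‖obliqueProj A B‖ * (D * e)) * (‖J‖ + 1)) := by gcongr; linarith
    _ = _ := by ring

lemma vecNorm₂_mulVec_le (A : Matrix (Fin p) (Fin r) ℝ) (u : Fin r → ℝ) :
    vecNorm₂ (A *ᵥ u) ≤ ‖A‖ * vecNorm₂ u := by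
  have h : ‖A‖ = Real.sqrt (∑ i, ∑ j, A i j ^ 2) := by
    rw [← frobenius_sq_eq_sum, Real.sqrt_sq (norm_nonneg _)]
  have h0 : 0 ≤ ∑ i, ∑ j, A i j ^ 2 :=
    Finset.sum_nonneg fun i _ => Finset.sum_nonneg fun j _ => sq_nonneg _
  rw [vecNorm₂, vecNorm₂, h]
  exact (Real.sqrt_le_sqrt (sum_mulVec_sq_le A u)).trans_eq (Real.sqrt_mul h0 _)

end Oblique

/-- The invertibility facts behind the identification of the factor model. -/
lemma exists_inverses_of_full_rank {p r v : ℕ} (hp : r + v = p)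
    {A₁ : Matrix (Fin p) (Fin r) ℝ} {Q₁ : Matrix (Fin r) (Fin r) ℝ}
    {A₂ : Matrix (Fin p) (Fin v) ℝ} {Q₂ : Matrix (Fin v) (Fin v) ℝ}
    {B₁ : Matrix (Fin p) (Fin v) ℝ} {B₂ : Matrix (Fin p) (Fin r) ℝ}
    (hB₁ : B₁ᵀ * B₁ = 1) (hB₁A₁ : B₁ᵀ * A₁ = 0) (hB₂ : B₂ᵀ * B₂ = 1) (hB₂A₂ : B₂ᵀ * A₂ = 0)
    (hrank : (Matrix.fromCols (A₁ * Q₁) (A₂ * Q₂)).rank = p) :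
    IsUnit Q₁.det ∧ IsUnit Q₂.det ∧ IsUnit (B₂ᵀ * A₁).det ∧ IsUnit (B₁ᵀ * A₂).det := by
  obtain ⟨X, hX⟩ := exists_right_inverse_of_rank _ (hrank.trans (Fintype.card_fin p).symm)
  -- `L` is square, so its right inverse is also a left inverse; the diagonal blocks of `X L = 1`
  -- invert `Q₁` and `Q₂`.
  have hX' := (Matrix.mul_eq_one_comm_of_equiv (finSumFinEquiv.trans (finCongr hp)).symm).1 hX
  rw [← Matrix.fromRows_toRows X, Matrix.fromCols_mul_fromRows] at hX
  rw [← Matrix.fromRows_toRows X, Matrix.fromRows_mul_fromCols, ← Matrix.fromBlocks_one,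
    Matrix.fromBlocks_inj] at hX'
  obtain ⟨h1, -, -, h2⟩ := hX'
  rw [← Matrix.mul_assoc] at h1 h2
  refine ⟨Matrix.isUnit_det_of_left_inverse h1, Matrix.isUnit_det_of_left_inverse h2, ?_, ?_⟩
  · refine Matrix.isUnit_det_of_right_inverse (B := Q₁ * X.toRows₁ * B₂) ?_
    -- Compressing `L X = 1` by `B₂` kills the `A₂` term and leaves a right inverse of `B₂ᵀ A₁`.
    have := congr_arg (fun Z => B₂ᵀ * Z * B₂) hX
    simp only [Matrix.mul_add, Matrix.mul_one, hB₂, ← Matrix.mul_assoc, hB₂A₂,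
      Matrix.zero_mul, add_zero] at this
    simpa only [← Matrix.mul_assoc] using this
  · refine Matrix.isUnit_det_of_right_inverse (B := Q₂ * X.toRows₂ * B₁) ?_
    have := congr_arg (fun Z => B₁ᵀ * Z * B₁) hX
    simp only [Matrix.mul_add, Matrix.mul_one, hB₁, ← Matrix.mul_assoc, hB₁A₁,
      Matrix.zero_mul, zero_add] at this
    simpa only [← Matrix.mul_assoc] using this

/-! ### Covariance inequalities under α-mixing -/

section Mixing

variable {Ω : Type*} {m0 : MeasurableSpace Ω} {P : Measure Ω} [IsProbabilityMeasure P]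

/-- Conditioning replaces `Y` by `P[Y|m]`, whose `L¹` norm is the difference of its integrals over
the `m`-measurable set where it is nonnegative and over the complement; each is at most `c` in
absolute value. -/
lemma abs_integral_mul_le_of_setIntegral_le {m : MeasurableSpace Ω} (hm : m ≤ m0) {X Y : Ω → ℝ}
    {a c : ℝ} (ha : 0 ≤ a) (hX : StronglyMeasurable[m] X) (hXa : ∀ ω, |X ω| ≤ a)
    (hY : Integrable Y P) (hc : ∀ A, MeasurableSet[m] A → |∫ ω in A, Y ω ∂P| ≤ c) :
    |∫ ω, X ω * Y ω ∂P| ≤ 2 * a * c := by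
  have hg : StronglyMeasurable[m] (P[Y|m]) := stronglyMeasurable_condExp
  have hgi : Integrable (P[Y|m]) P := integrable_condExp
  have h1 : ∫ ω, X ω * Y ω ∂P = ∫ ω, X ω * (P[Y|m]) ω ∂P := by
    rw [← integral_condExp hm]
    exact integral_congr_ae
      (condExp_stronglyMeasurable_mul_of_bound hm hX hY a (Eventually.of_forall hXa))
  set A := {ω | 0 ≤ (P[Y|m]) ω} with hA
  have hAm : MeasurableSet[m] A := hg.measurable measurableSet_Ici
  have h2 : ∫ ω, |(P[Y|m]) ω| ∂P ≤ 2 * c := by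
    rw [← integral_add_compl (hm _ hAm) hgi.abs,
      setIntegral_congr_fun (g := P[Y|m]) (hm _ hAm) fun ω hω => abs_of_nonneg hω,
      setIntegral_congr_fun (g := fun ω => -(P[Y|m]) ω) (hm _ hAm).compl
        fun ω hω => abs_of_neg (not_le.1 hω),
      integral_neg, setIntegral_condExp hm hY hAm, setIntegral_condExp hm hY hAm.compl]
    have h3 := abs_le.1 (hc A hAm)
    have h4 := abs_le.1 (hc Aᶜ hAm.compl)
    linarith
  rw [h1]
  calc |∫ ω, X ω * (P[Y|m]) ω ∂P| ≤ ∫ ω, |X ω * (P[Y|m]) ω| ∂P := abs_integral_le_integral_abs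
    _ ≤ ∫ ω, a * |(P[Y|m]) ω| ∂P := by
        refine integral_mono_of_nonneg (Eventually.of_forall fun ω => abs_nonneg _)
          (hgi.abs.const_mul a) (Eventually.of_forall fun ω => ?_)
        simp only [abs_mul]
        gcongr
        exact hXa ω
    _ = a * ∫ ω, |(P[Y|m]) ω| ∂P := integral_const_mul _ _
    _ ≤ a * (2 * c) := by gcongr
    _ = _ := by ring

/-- The preceding lemma is used twice: with an indicator of an `m₂`-event in place of `Y` it bounds
the set integrals of `X - E X` by `2 a α`, and these are the input for pairing with `Y`. -/
lemma abs_covariance_le_of_bounded {m₁ m₂ : MeasurableSpace Ω} (hm₁ : m₁ ≤ m0) (hm₂ : m₂ ≤ m0)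
    {X Y : Ω → ℝ} {a α : ℝ} (ha : 0 ≤ a) (hX : Measurable[m₁] X) (hXa : ∀ ω, |X ω| ≤ a)
    (hY : Measurable[m₂] Y) (hYa : ∀ ω, |Y ω| ≤ a)
    (hα : ∀ A B, MeasurableSet[m₁] A → MeasurableSet[m₂] B →
      |P.real (A ∩ B) - P.real A * P.real B| ≤ α) :
    |∫ ω, X ω * Y ω ∂P - (∫ ω, X ω ∂P) * ∫ ω, Y ω ∂P| ≤ 4 * α * a ^ 2 := by
  have hXi : Integrable X P := Integrable.of_bound (hX.mono hm₁ le_rfl).aestronglyMeasurable a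
    (Eventually.of_forall hXa)
  have hYi : Integrable Y P := Integrable.of_bound (hY.mono hm₂ le_rfl).aestronglyMeasurable a
    (Eventually.of_forall hYa)
  have step1 : ∀ B, MeasurableSet[m₂] B → |∫ ω in B, (X ω - ∫ ω, X ω ∂P) ∂P| ≤ 2 * a * α := by
    intro B hB
    have hBi : Integrable (fun ω => B.indicator (fun _ => (1 : ℝ)) ω - P.real B) P :=
      ((integrable_const 1).indicator (hm₂ _ hB)).sub (integrable_const _)
    have h := abs_integral_mul_le_of_setIntegral_le (c := α) hm₁ ha hX.stronglyMeasurable hXa hBi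
      fun A hA => by
        have hind : IntegrableOn (B.indicator fun _ => (1 : ℝ)) A P :=
          ((integrable_const 1).indicator (hm₂ _ hB)).integrableOn
        rw [integral_sub hind (integrable_const _), setIntegral_indicator (hm₂ _ hB)]
        simpa using hα A B hA hB
    have e : ∫ ω, X ω * (B.indicator (fun _ => (1 : ℝ)) ω - P.real B) ∂P =
        ∫ ω in B, (X ω - ∫ ω, X ω ∂P) ∂P := by
      have e1 : ∀ ω, X ω * (B.indicator (fun _ => (1 : ℝ)) ω - P.real B) =
          B.indicator X ω - P.real B * X ω := fun ω => by
        by_cases hω : ω ∈ B <;> simp [hω] <;> ring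
      simp_rw [e1]
      rw [integral_sub (hXi.indicator (hm₂ _ hB)) (hXi.const_mul _), integral_const_mul,
        integral_indicator (hm₂ _ hB), integral_sub hXi.integrableOn (integrable_const _)]
      simp
    rwa [e] at h
  have h := abs_integral_mul_le_of_setIntegral_le hm₂ ha hY.stronglyMeasurable hYa
    (hXi.sub (integrable_const (∫ ω, X ω ∂P))) step1
  have hYX : Integrable (fun ω => Y ω * X ω) P :=
    hXi.bdd_mul hYi.aestronglyMeasurable (Eventually.of_forall hYa)
  have e : ∫ ω, Y ω * (X ω - ∫ ω, X ω ∂P) ∂P =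
      ∫ ω, X ω * Y ω ∂P - (∫ ω, X ω ∂P) * ∫ ω, Y ω ∂P := by
    simp only [mul_sub]
    rw [integral_sub hYX (hYi.mul_const _), integral_mul_const]
    simp only [mul_comm]
  rw [← e]
  exact h.trans_eq (by ring)

/-- Truncation at level `a`. -/
noncomputable def clip (a x : ℝ) : ℝ := max (-a) (min a x)

lemma measurable_clip (a : ℝ) : Measurable (clip a) :=
  measurable_const.max (measurable_const.min measurable_id)

lemma abs_clip_le {a : ℝ} (ha : 0 ≤ a) (x : ℝ) : |clip a x| ≤ a :=
  abs_le.2 ⟨le_max_left _ _, max_le (by linarith) (min_le_left _ _)⟩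

lemma clip_of_abs_le {a x : ℝ} (h : |x| ≤ a) : clip a x = x := by
  rw [abs_le] at h
  rw [clip, min_eq_right h.2, max_eq_right h.1]

lemma exists_clip_eq_mul {a : ℝ} (ha : 0 ≤ a) (x : ℝ) :
    ∃ s, 0 ≤ s ∧ s ≤ 1 ∧ clip a x = s * x := by
  rcases le_or_gt |x| a with h | h
  · exact ⟨1, zero_le_one, le_rfl, by rw [clip_of_abs_le h, one_mul]⟩
  · have hx : 0 < |x| := ha.trans_lt h
    refine ⟨a / |x|, by positivity, (div_le_one hx).2 h.le, ?_⟩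
    rcases le_total 0 x with h0 | h0
    · rw [abs_of_nonneg h0] at h hx ⊢
      rw [clip, min_eq_left h.le, max_eq_right (by linarith), div_mul_cancel₀ _ hx.ne']
    · rw [abs_of_nonpos h0] at h hx ⊢
      rw [clip, min_eq_right (by linarith), max_eq_left (by linarith), div_neg, neg_mul,
        div_mul_cancel₀ _ (by linarith)]

/-- The error vanishes unless `b = max |x| |y|` exceeds `a`; then it is at most `b² = b^γ b^(2-γ)`,
and `b^(2-γ) ≤ a^(2-γ)` because the exponent is not positive. -/
lemma abs_mul_sub_clip_mul_clip_le {a γ : ℝ} (ha : 0 < a) (hγ : 2 ≤ γ) (x y : ℝ) :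
    |x * y - clip a x * clip a y| ≤ (|x| ^ γ + |y| ^ γ) * a ^ (2 - γ) := by
  have hx0 : 0 ≤ |x| ^ γ := by positivity
  have hy0 : 0 ≤ |y| ^ γ := by positivity
  rcases le_or_gt (max |x| |y|) a with h | h
  · rw [clip_of_abs_le ((le_max_left _ _).trans h), clip_of_abs_le ((le_max_right _ _).trans h),
      sub_self, abs_zero]
    positivity
  · obtain ⟨s, hs0, hs1, hs⟩ := exists_clip_eq_mul ha.le x
    obtain ⟨t, ht0, ht1, ht⟩ := exists_clip_eq_mul ha.le y
    set b := max |x| |y| with hb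
    have hb0 : 0 < b := ha.trans h
    have hst : s * t ≤ 1 := mul_le_one₀ hs1 ht0 ht1
    have hst0 : 0 ≤ s * t := mul_nonneg hs0 ht0
    calc |x * y - clip a x * clip a y| = |(x * y) * (1 - s * t)| := by rw [hs, ht]; ring_nf
      _ = |x| * |y| * (1 - s * t) := by rw [abs_mul, abs_mul, abs_of_nonneg (sub_nonneg.2 hst)]
      _ ≤ b * b * 1 := by
          gcongr
          · exact le_max_left _ _
          · exact le_max_right _ _
          · linarith
      _ = b ^ γ * b ^ (2 - γ) := by
          rw [← Real.rpow_add hb0, add_sub_cancel, Real.rpow_two]; ring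
      _ ≤ (|x| ^ γ + |y| ^ γ) * a ^ (2 - γ) := by
          refine mul_le_mul ?_ (Real.rpow_le_rpow_of_nonpos ha h.le (by linarith)) (by positivity)
            (by positivity)
          rcases max_choice |x| |y| with h' | h' <;> rw [hb, h'] <;> linarith

lemma integrable_mul_of_rpow {γ : ℝ} (hγ : 2 ≤ γ) {X Y : Ω → ℝ} (hX : Measurable X)
    (hY : Measurable Y) (hXi : Integrable (fun ω => |X ω| ^ γ) P)
    (hYi : Integrable (fun ω => |Y ω| ^ γ) P) : Integrable (fun ω => X ω * Y ω) P := by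
  refine ((integrable_const (1 : ℝ)).add (hXi.add hYi)).mono' (hX.mul hY).aestronglyMeasurable
    (Eventually.of_forall fun ω => ?_)
  have h := abs_mul_sub_clip_mul_clip_le one_pos hγ (X ω) (Y ω)
  rw [Real.one_rpow, mul_one] at h
  have h2 : |clip 1 (X ω) * clip 1 (Y ω)| ≤ 1 := by
    rw [abs_mul]
    exact mul_le_one₀ (abs_clip_le zero_le_one _) (abs_nonneg _) (abs_clip_le zero_le_one _)
  have h3 := abs_sub_abs_le_abs_sub (X ω * Y ω) (clip 1 (X ω) * clip 1 (Y ω))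
  simp only [Pi.add_apply, Real.norm_eq_abs]
  linarith

lemma memLp_two_of_rpow {γ : ℝ} (hγ : 2 ≤ γ) {X : Ω → ℝ} (hX : Measurable X)
    (hXi : Integrable (fun ω => |X ω| ^ γ) P) : MemLp X 2 P := by
  rw [memLp_two_iff_integrable_sq hX.aestronglyMeasurable]
  simpa only [pow_two] using integrable_mul_of_rpow hγ hX hX hXi hXi

lemma abs_integral_mul_sub_clip_le {a γ M : ℝ} (ha : 0 < a) (hγ : 2 ≤ γ) {X Y : Ω → ℝ}
    (hX : Measurable X) (hY : Measurable Y) (hXi : Integrable (fun ω => |X ω| ^ γ) P)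
    (hYi : Integrable (fun ω => |Y ω| ^ γ) P) (hXM : ∫ ω, |X ω| ^ γ ∂P ≤ M)
    (hYM : ∫ ω, |Y ω| ^ γ ∂P ≤ M) :
    |∫ ω, X ω * Y ω ∂P - ∫ ω, clip a (X ω) * clip a (Y ω) ∂P| ≤ 2 * M * a ^ (2 - γ) := by
  have hcl : Integrable (fun ω => clip a (X ω) * clip a (Y ω)) P := by
    refine Integrable.of_bound (((measurable_clip a).comp hX).mul
      ((measurable_clip a).comp hY)).aestronglyMeasurable (a * a) (Eventually.of_forall fun ω => ?_)
    rw [Real.norm_eq_abs, abs_mul]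
    exact mul_le_mul (abs_clip_le ha.le _) (abs_clip_le ha.le _) (abs_nonneg _) ha.le
  rw [← integral_sub (integrable_mul_of_rpow hγ hX hY hXi hYi) hcl]
  calc _ ≤ ∫ ω, |X ω * Y ω - clip a (X ω) * clip a (Y ω)| ∂P := abs_integral_le_integral_abs
    _ ≤ ∫ ω, (|X ω| ^ γ + |Y ω| ^ γ) * a ^ (2 - γ) ∂P :=
        integral_mono_of_nonneg (Eventually.of_forall fun ω => abs_nonneg _)
          ((hXi.add hYi).mul_const _)
          (Eventually.of_forall fun ω => abs_mul_sub_clip_mul_clip_le ha hγ _ _)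
    _ = (∫ ω, |X ω| ^ γ ∂P + ∫ ω, |Y ω| ^ γ ∂P) * a ^ (2 - γ) := by
        rw [integral_mul_const, integral_add hXi hYi]
    _ ≤ _ := by gcongr; linarith

/-- A product of expectations is the expectation of a product under `P.prod P`, so the truncation
bound for joint expectations applies to independent copies. -/
lemma abs_integral_mul_integral_sub_clip_le {a γ M : ℝ} (ha : 0 < a) (hγ : 2 ≤ γ) {X Y : Ω → ℝ}
    (hX : Measurable X) (hY : Measurable Y) (hXi : Integrable (fun ω => |X ω| ^ γ) P)
    (hYi : Integrable (fun ω => |Y ω| ^ γ) P) (hXM : ∫ ω, |X ω| ^ γ ∂P ≤ M)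
    (hYM : ∫ ω, |Y ω| ^ γ ∂P ≤ M) :
    |(∫ ω, X ω ∂P) * (∫ ω, Y ω ∂P) - (∫ ω, clip a (X ω) ∂P) * ∫ ω, clip a (Y ω) ∂P| ≤
      2 * M * a ^ (2 - γ) := by
  rw [← integral_prod_mul X Y, ← integral_prod_mul (fun ω => clip a (X ω)) fun ω => clip a (Y ω)]
  exact abs_integral_mul_sub_clip_le (P := P.prod P) ha hγ (hX.comp measurable_fst)
    (hY.comp measurable_snd) (hXi.comp_fst P) (hYi.comp_snd P)
    ((integral_fun_fst (μ := P) (ν := P) (fun ω => |X ω| ^ γ)).trans_le (by simpa using hXM))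
    ((integral_fun_snd (μ := P) (ν := P) (fun ω => |Y ω| ^ γ)).trans_le (by simpa using hYM))

/-- Davydov's covariance inequality, for random variables with bounded `γ`-th moments. -/
lemma abs_covariance_le_of_mixing {m₁ m₂ : MeasurableSpace Ω} (hm₁ : m₁ ≤ m0) (hm₂ : m₂ ≤ m0)
    {X Y : Ω → ℝ} {α γ M : ℝ} (hγ : 2 < γ) (hα0 : 0 < α) (hX : Measurable[m₁] X)
    (hY : Measurable[m₂] Y) (hXi : Integrable (fun ω => |X ω| ^ γ) P)
    (hYi : Integrable (fun ω => |Y ω| ^ γ) P) (hXM : ∫ ω, |X ω| ^ γ ∂P ≤ M)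
    (hYM : ∫ ω, |Y ω| ^ γ ∂P ≤ M)
    (hα : ∀ A B, MeasurableSet[m₁] A → MeasurableSet[m₂] B →
      |P.real (A ∩ B) - P.real A * P.real B| ≤ α) :
    |cov[X, Y; P]| ≤ 4 * (1 + M) * α ^ (1 - 2 / γ) := by
  have hX' := hX.mono hm₁ le_rfl
  have hY' := hY.mono hm₂ le_rfl
  -- This level balances the bounded part `α a²` against the truncation error `a^(2-γ)`: both become
  -- `α^(1-2/γ)`.
  set a := α ^ (-1 / γ) with ha
  have ha0 : 0 < a := Real.rpow_pos_of_pos hα0 _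
  have hγ0 : γ ≠ 0 := by linarith
  have e1 : α * a ^ 2 = α ^ (1 - 2 / γ) := by
    rw [ha, ← Real.rpow_natCast, ← Real.rpow_mul hα0.le]
    nth_rw 1 [← Real.rpow_one α]
    rw [← Real.rpow_add hα0]
    congr 1
    push_cast; ring
  have e2 : a ^ (2 - γ) = α ^ (1 - 2 / γ) := by
    rw [ha, ← Real.rpow_mul hα0.le]
    congr 1
    field_simp; ring
  have h1 := abs_integral_mul_sub_clip_le ha0 hγ.le hX' hY' hXi hYi hXM hYM
  have h2 := abs_integral_mul_integral_sub_clip_le ha0 hγ.le hX' hY' hXi hYi hXM hYM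
  have h3 := abs_covariance_le_of_bounded hm₁ hm₂ ha0.le ((measurable_clip a).comp hX)
    (fun ω => abs_clip_le ha0.le _) ((measurable_clip a).comp hY)
    (fun ω => abs_clip_le ha0.le _) hα
  simp only [Function.comp_apply] at h3
  rw [covariance_eq_sub (memLp_two_of_rpow hγ.le hX' hXi) (memLp_two_of_rpow hγ.le hY' hYi)]
  simp only [Pi.mul_apply]
  rw [e2] at h1 h2
  rw [show 4 * α * a ^ 2 = 4 * (α * a ^ 2) by ring, e1] at h3
  rw [abs_le] at *
  constructor <;> linarith [h1.1, h1.2, h2.1, h2.2, h3.1, h3.2]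

end Mixing

/-! ### Calculus of stochastic orders -/

namespace IsBigOp

variable {Ω : Type*} [MeasurableSpace Ω] {P : Measure Ω} {X Y W : ℕ → Ω → ℝ} {a b : ℕ → ℝ}

lemma of_le (hY : IsBigOp P Y a) {C : ℝ} (hC : 0 < C)
    (h : ∀ᶠ n in atTop, ∀ ω, |X n ω| ≤ C * |Y n ω|) : IsBigOp P X a := by
  intro δ hδ
  obtain ⟨K, hK, hn⟩ := hY δ hδ
  refine ⟨C * K, by positivity, ?_⟩
  filter_upwards [hn, h] with n hn h
  refine (measure_mono fun ω hω => ?_).trans hn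
  simp only [Set.mem_ofPred_eq] at hω ⊢
  have := hω.trans_le (h ω)
  rw [mul_assoc] at this
  exact lt_of_mul_lt_mul_left this hC.le

lemma mono_rate (hX : IsBigOp P X a) (h : ∀ᶠ n in atTop, a n ≤ b n) : IsBigOp P X b := by
  intro δ hδ
  obtain ⟨K, hK, hn⟩ := hX δ hδ
  refine ⟨K, hK, ?_⟩
  filter_upwards [hn, h] with n hn h
  exact (measure_mono fun ω hω => (mul_le_mul_of_nonneg_left h hK.le).trans_lt hω).trans hn

lemma of_bounded {C : ℝ} (h : ∀ᶠ n in atTop, ∀ ω, |X n ω| ≤ C * a n)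
    (ha : ∀ᶠ n in atTop, 0 ≤ a n) : IsBigOp P X a := by
  intro δ hδ
  refine ⟨|C| + 1, by positivity, ?_⟩
  filter_upwards [h, ha] with n h ha
  have : {ω | (|C| + 1) * a n < |X n ω|} = ∅ := by
    ext ω
    simp only [Set.mem_ofPred_eq, Set.mem_empty_iff_false, iff_false, not_lt]
    refine (h ω).trans (mul_le_mul_of_nonneg_right ?_ ha)
    linarith [le_abs_self C]
  rw [this]
  simp

lemma add (hX : IsBigOp P X a) (hY : IsBigOp P Y a) :
    IsBigOp P (fun n ω => X n ω + Y n ω) a := by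
  intro δ hδ
  obtain ⟨K, hK, hn⟩ := hX (δ / 2) (by positivity)
  obtain ⟨K', hK', hn'⟩ := hY (δ / 2) (by positivity)
  refine ⟨K + K', by positivity, ?_⟩
  filter_upwards [hn, hn'] with n hn hn'
  calc P {ω | (K + K') * a n < |X n ω + Y n ω|}
      ≤ P ({ω | K * a n < |X n ω|} ∪ {ω | K' * a n < |Y n ω|}) := by
        refine measure_mono fun ω hω => ?_
        simp only [Set.mem_ofPred_eq, Set.mem_union] at hω ⊢
        by_contra! hcon
        have := abs_add_le (X n ω) (Y n ω)
        linarith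
    _ ≤ ENNReal.ofReal (δ / 2) + ENNReal.ofReal (δ / 2) :=
        (measure_union_le _ _).trans (add_le_add hn hn')
    _ = ENNReal.ofReal δ := by
        rw [← ENNReal.ofReal_add (by positivity) (by positivity), add_halves]

lemma mul (hX : IsBigOp P X a) (hY : IsBigOp P Y b) (ha : ∀ n, 0 ≤ a n) :
    IsBigOp P (fun n ω => X n ω * Y n ω) (fun n => a n * b n) := by
  intro δ hδ
  obtain ⟨K, hK, hn⟩ := hX (δ / 2) (by positivity)
  obtain ⟨K', hK', hn'⟩ := hY (δ / 2) (by positivity)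
  refine ⟨K * K', by positivity, ?_⟩
  filter_upwards [hn, hn'] with n hn hn'
  calc P {ω | (K * K') * (a n * b n) < |X n ω * Y n ω|}
      ≤ P ({ω | K * a n < |X n ω|} ∪ {ω | K' * b n < |Y n ω|}) := by
        refine measure_mono fun ω hω => ?_
        simp only [Set.mem_ofPred_eq, Set.mem_union] at hω ⊢
        by_contra! hcon
        rw [abs_mul] at hω
        have := mul_le_mul hcon.1 hcon.2 (abs_nonneg _) (mul_nonneg hK.le (ha n))
        nlinarith
    _ ≤ ENNReal.ofReal (δ / 2) + ENNReal.ofReal (δ / 2) :=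
        (measure_union_le _ _).trans (add_le_add hn hn')
    _ = ENNReal.ofReal δ := by
        rw [← ENNReal.ofReal_add (by positivity) (by positivity), add_halves]

lemma sum {ι : Type*} (s : Finset ι) {X : ι → ℕ → Ω → ℝ} (ha : ∀ n, 0 ≤ a n)
    (h : ∀ i ∈ s, IsBigOp P (X i) a) : IsBigOp P (fun n ω => ∑ i ∈ s, X i n ω) a := by
  classical
  induction s using Finset.induction_on with
  | empty => exact of_bounded (C := 0) (by simp) (Eventually.of_forall ha)
  | insert i s hi ih =>
    simp only [Finset.sum_insert hi]
    exact (h i (Finset.mem_insert_self _ _)).add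
      (ih fun j hj => h j (Finset.mem_insert_of_mem hj))

/-- A bound valid only while `X` is small suffices, since `X` tends to `0` in probability. This
serves the oblique projection, whose Lipschitz bound is local. -/
lemma of_le_of_small (hX : IsBigOp P X a) (ha : Tendsto a atTop (nhds 0)) {c : ℝ} (hc : 0 < c)
    (hW : IsBigOp P W b) (h : ∀ n ω, |X n ω| ≤ c → |Y n ω| ≤ |W n ω|) : IsBigOp P Y b := by
  intro δ hδ
  obtain ⟨K, hK, hn⟩ := hX (δ / 2) (by positivity)
  obtain ⟨K', hK', hn'⟩ := hW (δ / 2) (by positivity)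
  refine ⟨K', by positivity, ?_⟩
  have hsm : ∀ᶠ n in atTop, K * a n < c := by
    have := ha.const_mul K
    rw [mul_zero] at this
    exact this.eventually_lt_const hc
  filter_upwards [hn, hn', hsm] with n hn hn' hsm
  calc P {ω | K' * b n < |Y n ω|}
      ≤ P ({ω | K * a n < |X n ω|} ∪ {ω | K' * b n < |W n ω|}) := by
        refine measure_mono fun ω hω => ?_
        simp only [Set.mem_ofPred_eq, Set.mem_union] at hω ⊢
        by_contra! hcon
        have := h n ω (hcon.1.trans hsm.le)
        linarith
    _ ≤ ENNReal.ofReal (δ / 2) + ENNReal.ofReal (δ / 2) :=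
        (measure_union_le _ _).trans (add_le_add hn hn')
    _ = ENNReal.ofReal δ := by
        rw [← ENNReal.ofReal_add (by positivity) (by positivity), add_halves]

end IsBigOp

/-- The parametric rate `n ^ (-1/2)`. -/
noncomputable def rootRate (n : ℕ) : ℝ := (n : ℝ) ^ (-(1 / 2) : ℝ)

lemma rootRate_nonneg (n : ℕ) : 0 ≤ rootRate n := by unfold rootRate; positivity

lemma rootRate_pos {n : ℕ} (hn : 0 < n) : 0 < rootRate n := by unfold rootRate; positivity

lemma rootRate_sq {n : ℕ} : rootRate n ^ 2 = (n : ℝ)⁻¹ := by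
  rw [rootRate, ← Real.rpow_natCast, ← Real.rpow_mul (by positivity), ← Real.rpow_neg_one]
  norm_num

lemma tendsto_rootRate : Tendsto rootRate atTop (nhds 0) :=
  (tendsto_rpow_neg_atTop (by norm_num)).comp tendsto_natCast_atTop_atTop

lemma rootRate_le_one {n : ℕ} (hn : 0 < n) : rootRate n ≤ 1 :=
  Real.rpow_le_one_of_one_le_of_nonpos (by exact_mod_cast hn) (by norm_num)

lemma inv_le_rootRate (n : ℕ) : (n : ℝ)⁻¹ ≤ rootRate n := by
  rw [← rootRate_sq]
  rcases n.eq_zero_or_pos with rfl | hn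
  · simp [rootRate]
  · nlinarith [rootRate_le_one hn, rootRate_pos hn]

section

variable {Ω : Type*} [MeasurableSpace Ω] {P : Measure Ω} {X Y : ℕ → Ω → ℝ}

lemma IsBigOp.rootRate_one (hX : IsBigOp P X rootRate) : IsBigOp P X fun _ => 1 :=
  hX.mono_rate ((eventually_gt_atTop 0).mono fun _ hn => rootRate_le_one hn)

lemma IsBigOp.mul_one_rate (hX : IsBigOp P X rootRate) (hY : IsBigOp P Y fun _ => 1) :
    IsBigOp P (fun n ω => X n ω * Y n ω) rootRate := by
  simpa using hX.mul hY rootRate_nonneg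

lemma isBigOp_const (c : ℝ) : IsBigOp P (fun _ _ => c) fun _ => 1 :=
  IsBigOp.of_bounded (C := |c|) (by simp) (by simp)

lemma isBigOp_of_variance_le [IsProbabilityMeasure P] {C : ℝ} {a : ℕ → ℝ}
    (ha : ∀ᶠ n in atTop, 0 < a n) (hX : ∀ n, MemLp (X n) 2 P)
    (hV : ∀ᶠ n in atTop, Var[X n; P] ≤ C * a n ^ 2) :
    IsBigOp P (fun n ω => X n ω - P[X n]) a := by
  intro δ hδ
  -- Chebyshev needs `C ≤ δ K²`; the `+ 1` makes `K` positive.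
  refine ⟨Real.sqrt (C / δ) + 1, by positivity, ?_⟩
  filter_upwards [ha, hV] with n ha hV
  set K := Real.sqrt (C / δ) + 1 with hK
  have hK0 : 0 < K := by positivity
  have hK2 : C ≤ δ * K ^ 2 := by
    have h1 : C / δ ≤ K ^ 2 := by
      rw [← Real.sqrt_le_left hK0.le]; linarith
    rw [div_le_iff₀ hδ] at h1
    linarith
  calc P {ω | K * a n < |X n ω - P[X n]|}
      ≤ P {ω | K * a n ≤ |X n ω - P[X n]|} := by
        refine measure_mono fun ω hω => ?_
        simp only [Set.mem_ofPred_eq] at hω ⊢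
        exact hω.le
    _ ≤ ENNReal.ofReal (Var[X n; P] / (K * a n) ^ 2) :=
        meas_ge_le_variance_div_sq (hX n) (by positivity)
    _ ≤ ENNReal.ofReal δ := by
        refine ENNReal.ofReal_le_ofReal ?_
        rw [div_le_iff₀ (by positivity), mul_pow, ← mul_assoc]
        exact hV.trans (by gcongr)

end

/-! ### Averages of functionals of a mixing process -/

section Averages

variable {Ω E : Type*} [MeasurableSpace Ω] [MeasurableSpace E] {P : Measure Ω}
  {Z : ℤ → Ω → E}

lemma abs_measureReal_inter_sub_le_one [IsProbabilityMeasure P] (A B : Set Ω) :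
    |P.real (A ∩ B) - P.real A * P.real B| ≤ 1 := by
  have h1 : P.real (A ∩ B) ≤ 1 := measureReal_le_one
  have h2 : P.real A * P.real B ≤ 1 :=
    mul_le_one₀ measureReal_le_one measureReal_nonneg measureReal_le_one
  have h3 : 0 ≤ P.real (A ∩ B) := measureReal_nonneg
  have h4 : 0 ≤ P.real A * P.real B := mul_nonneg measureReal_nonneg measureReal_nonneg
  rw [abs_le]
  constructor <;> linarith

lemma le_alphaMixing [IsProbabilityMeasure P] {i : ℤ} {k : ℕ} {A B : Set Ω} (hA : MeasurableSet[pastSigma Z i] A)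
    (hB : MeasurableSet[futureSigma Z (i + k)] B) :
    |P.real (A ∩ B) - P.real A * P.real B| ≤ alphaMixing P Z k := by
  -- The set is bounded above by `1`, so `sSup` is a genuine supremum and not a default value.
  refine le_csSup ⟨1, ?_⟩ ⟨i, A, B, hA, hB, rfl⟩
  rintro x ⟨i, A, B, -, -, rfl⟩
  exact abs_measureReal_inter_sub_le_one A B

lemma alphaMixing_nonneg (k : ℕ) : 0 ≤ alphaMixing P Z k := by
  refine Real.sSup_nonneg ?_
  rintro x ⟨i, A, B, -, -, rfl⟩
  exact abs_nonneg _

lemma pastSigma_le (hZ : ∀ t, Measurable (Z t)) (i : ℤ) : pastSigma Z i ≤ ‹MeasurableSpace Ω› :=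
  iSup₂_le fun t _ => (hZ t).comap_le

lemma futureSigma_le (hZ : ∀ t, Measurable (Z t)) (i : ℤ) :
    futureSigma Z i ≤ ‹MeasurableSpace Ω› :=
  iSup₂_le fun t _ => (hZ t).comap_le

lemma measurable_pastSigma {Ω E : Type*} [MeasurableSpace E] {Z : ℤ → Ω → E} {i t : ℤ} (h : t ≤ i) : Measurable[pastSigma Z i] (Z t) :=
  Measurable.of_comap_le (le_iSup₂_of_le t h le_rfl)

lemma measurable_futureSigma {Ω E : Type*} [MeasurableSpace E] {Z : ℤ → Ω → E} {i t : ℤ} (h : i ≤ t) : Measurable[futureSigma Z i] (Z t) :=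
  Measurable.of_comap_le (le_iSup₂_of_le t h le_rfl)

/-- A positive summable majorant of `α(j) ^ (1 - 2 / γ)`, set to `1` at `j = 0`. -/
noncomputable def mixingRate (P : Measure Ω) (Z : ℤ → Ω → E) (γ : ℝ) : ℕ → ℝ
  | 0 => 1
  -- The geometric term keeps the rate positive where `α` vanishes, as `abs_covariance_le_of_mixing`
  -- requires.
  | j + 1 => alphaMixing P Z (j + 1) ^ (1 - 2 / γ) + (1 / 2) ^ j

lemma mixingRate_pos (γ : ℝ) (j : ℕ) : 0 < mixingRate P Z γ j := by
  cases j with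
  | zero => exact one_pos
  | succ j =>
    have := Real.rpow_nonneg (alphaMixing_nonneg (P := P) (Z := Z) (j + 1)) (1 - 2 / γ)
    simp only [mixingRate]
    positivity

lemma summable_mixingRate {γ : ℝ}
    (h : Summable fun k : ℕ => alphaMixing P Z (k + 1) ^ (1 - 2 / γ)) :
    Summable (mixingRate P Z γ) := by
  rw [← summable_nat_add_iff 1]
  exact h.add (summable_geometric_of_lt_one (by norm_num) (by norm_num))

/-- A process `ξ` with bounded `γ`-th moments such that `ξ t` is a function of
`Z (t - k), ..., Z t`. -/
structure IsLocalFunctional (P : Measure Ω) (Z : ℤ → Ω → E) (γ M : ℝ) (k : ℕ)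
    (ξ : ℤ → Ω → ℝ) : Prop where
  past : ∀ t, Measurable[pastSigma Z t] (ξ t)
  future : ∀ t, Measurable[futureSigma Z (t - k)] (ξ t)
  integrable : ∀ t, Integrable (fun ω => |ξ t ω| ^ γ) P
  moment : ∀ t, ∫ ω, |ξ t ω| ^ γ ∂P ≤ M

variable {γ M : ℝ} {k : ℕ} {ξ : ℤ → Ω → ℝ}

lemma IsLocalFunctional.measurable (h : IsLocalFunctional P Z γ M k ξ)
    (hZ : ∀ t, Measurable (Z t)) (t : ℤ) : Measurable (ξ t) :=
  (h.past t).mono (pastSigma_le hZ t) le_rfl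

/-- `ξ s` belongs to the past of `s` and `ξ t` to the future of `t - k`, so the effective lag is `t
- s - k`. For shorter distances the truncated subtraction gives lag `0`, where the trivial
coefficient `1` is used. -/
lemma IsLocalFunctional.abs_covariance_le_of_le [IsProbabilityMeasure P]
    (h : IsLocalFunctional P Z γ M k ξ)
    (hZ : ∀ t, Measurable (Z t)) (hγ : 2 < γ) {s t : ℤ} (hst : s ≤ t) :
    |cov[ξ s, ξ t; P]| ≤ 4 * (1 + M) * mixingRate P Z γ ((t - s).natAbs - k) := by
  have hq : 0 < 1 - 2 / γ := by
    rw [sub_pos, div_lt_one (by linarith)]; exact hγ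
  rcases hj : (t - s).natAbs - k with _ | j
  · have := abs_covariance_le_of_mixing le_rfl le_rfl hγ one_pos (h.measurable hZ s)
      (h.measurable hZ t) (h.integrable s) (h.integrable t) (h.moment s) (h.moment t)
      fun A B _ _ => abs_measureReal_inter_sub_le_one A B
    rwa [Real.one_rpow] at this
  · have hw := mixingRate_pos (P := P) (Z := Z) γ (j + 1)
    have htk : t - k = s + ((j + 1 : ℕ) : ℤ) := by omega
    -- This exponent is undone by the power `1 - 2/γ` in the covariance inequality, leaving
    -- `mixingRate` itself.
    have := abs_covariance_le_of_mixing (α := mixingRate P Z γ (j + 1) ^ (1 - 2 / γ)⁻¹)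
      (pastSigma_le hZ s) (futureSigma_le hZ (t - k)) hγ (by positivity) (h.past s) (h.future t)
      (h.integrable s) (h.integrable t) (h.moment s) (h.moment t) fun A B hA hB => by
        rw [htk] at hB
        refine (le_alphaMixing hA hB).trans ?_
        rw [Real.le_rpow_inv_iff_of_pos (alphaMixing_nonneg _) hw.le hq]
        simp only [mixingRate]
        have : (0 : ℝ) ≤ (1 / 2) ^ j := by positivity
        linarith
    rwa [← Real.rpow_mul hw.le, inv_mul_cancel₀ hq.ne', Real.rpow_one] at this

lemma IsLocalFunctional.abs_covariance_le [IsProbabilityMeasure P]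
    (h : IsLocalFunctional P Z γ M k ξ)
    (hZ : ∀ t, Measurable (Z t)) (hγ : 2 < γ) (s t : ℤ) :
    |cov[ξ s, ξ t; P]| ≤ 4 * (1 + M) * mixingRate P Z γ ((t - s).natAbs - k) := by
  rcases le_total s t with hst | hst
  · exact h.abs_covariance_le_of_le hZ hγ hst
  · rw [covariance_comm, ← Int.natAbs_neg, neg_sub]
    exact h.abs_covariance_le_of_le hZ hγ hst

/-- Each distance to `s` occurs at most once on either side of `s`. -/
lemma sum_natAbs_sub_le {u : ℕ → ℝ} (hu : ∀ j, 0 ≤ u j) (hs : Summable u) (T : Finset ℕ) (s : ℕ) :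
    ∑ t ∈ T, u ((t : ℤ) - s).natAbs ≤ 2 * ∑' j, u j := by
  have key : ∀ T : Finset ℕ, (Set.InjOn (fun t : ℕ => ((t : ℤ) - s).natAbs) T) →
      ∑ t ∈ T, u ((t : ℤ) - s).natAbs ≤ ∑' j, u j := fun T hT => by
    rw [← Finset.sum_image (f := u) hT]
    exact hs.sum_le_tsum _ fun j _ => hu j
  rw [← Finset.sum_filter_add_sum_filter_not T (fun t => s ≤ t), two_mul]
  refine add_le_add (key _ ?_) (key _ ?_)
  · intro x hx y hy hxy
    simp only [Finset.coe_filter, Set.mem_ofPred_eq] at hx hy hxy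
    omega
  · intro x hx y hy hxy
    simp only [Finset.coe_filter, Set.mem_ofPred_eq] at hx hy hxy
    omega

/-- Averages of a local functional of a mixing process converge at the parametric rate. -/
lemma IsLocalFunctional.isBigOp_average_sub [IsProbabilityMeasure P]
    (h : IsLocalFunctional P Z γ M k ξ)
    (hZ : ∀ t, Measurable (Z t)) (hγ : 2 < γ)
    (hmix : Summable fun k : ℕ => alphaMixing P Z (k + 1) ^ (1 - 2 / γ)) {c : ℝ}
    (hc : ∀ t, ∫ ω, ξ t ω ∂P = c) (l : ℕ) :
    IsBigOp P (fun n ω => (n : ℝ)⁻¹ * ∑ t ∈ Finset.Icc (l + 1) n, ξ t ω - c) rootRate := by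
  set u : ℕ → ℝ := fun j => 4 * (1 + M) * mixingRate P Z γ (j - k) with hu
  have hM : 0 ≤ M := (integral_nonneg fun ω => by positivity).trans (h.moment 0)
  have hu0 : ∀ j, 0 ≤ u j := fun j => by
    have := mixingRate_pos (P := P) (Z := Z) γ (j - k)
    simp only [hu]
    positivity
  have hus : Summable u := by
    refine Summable.mul_left _ ?_
    rw [← summable_nat_add_iff k]
    simpa using summable_mixingRate hmix
  have hmem : ∀ t, MemLp (ξ t) 2 P := fun t =>
    memLp_two_of_rpow hγ.le (h.measurable hZ t) (h.integrable t)
  have hmemX : ∀ n : ℕ, MemLp (fun ω => (n : ℝ)⁻¹ * ∑ t ∈ Finset.Icc (l + 1) n, ξ t ω) 2 P :=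
    fun n => (memLp_finsetSum (Finset.Icc (l + 1) n) fun t _ => hmem (t : ℤ)).const_mul _
  have hvar : ∀ n : ℕ, 0 < n →
      Var[fun ω => (n : ℝ)⁻¹ * ∑ t ∈ Finset.Icc (l + 1) n, ξ t ω; P] ≤ 2 * ∑' j, u j / n := by
    intro n hn
    have hn' : (0 : ℝ) < n := by exact_mod_cast hn
    rw [variance_const_mul, variance_fun_sum' (X := fun t : ℕ => ξ t) fun t _ => hmem t]
    have h1 : ∑ s ∈ Finset.Icc (l + 1) n, ∑ t ∈ Finset.Icc (l + 1) n, cov[ξ s, ξ t; P] ≤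
        n * (2 * ∑' j, u j) := by
      calc _ ≤ ∑ s ∈ Finset.Icc (l + 1) n, 2 * ∑' j, u j :=
            Finset.sum_le_sum fun s _ => (Finset.sum_le_sum fun (t : ℕ) _ =>
              (le_abs_self _).trans (h.abs_covariance_le hZ hγ s t)).trans
                (sum_natAbs_sub_le hu0 hus _ s)
        _ = ((n - l : ℕ) : ℝ) * (2 * ∑' j, u j) := by simp
        _ ≤ n * (2 * ∑' j, u j) := by
            have : 0 ≤ ∑' j, u j := tsum_nonneg hu0
            gcongr
            exact Nat.sub_le n l
    rw [tsum_div_const]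
    calc _ ≤ (n : ℝ)⁻¹ ^ 2 * (n * (2 * ∑' j, u j)) := by gcongr
      _ = _ := by field_simp
  have hb := isBigOp_of_variance_le (C := 2 * ∑' j, u j)
    ((eventually_gt_atTop 0).mono fun n hn => rootRate_pos hn) hmemX
    ((eventually_gt_atTop 0).mono fun n hn => by
      rw [rootRate_sq, ← div_eq_mul_inv, mul_div_assoc, ← tsum_div_const]
      exact hvar n hn)
  -- The sum has `n - l` terms but is divided by `n`, which leaves a bias `l |c| / n`.
  have hdet : IsBigOp P (fun n (_ : Ω) =>
      P[fun ω => (n : ℝ)⁻¹ * ∑ t ∈ Finset.Icc (l + 1) n, ξ t ω] - c) rootRate := by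
    refine IsBigOp.of_bounded (C := l * |c|) ?_ (Eventually.of_forall rootRate_nonneg)
    filter_upwards [eventually_ge_atTop l, eventually_gt_atTop 0] with n hn hn0 _
    have hn' : (0 : ℝ) < n := by exact_mod_cast hn0
    rw [integral_const_mul, integral_finsetSum (f := fun t : ℕ => ξ t) _ fun t _ =>
      (hmem t).integrable one_le_two]
    simp only [hc, Finset.sum_const, Nat.card_Icc, Nat.add_sub_add_right, nsmul_eq_mul,
      Nat.cast_sub hn]
    have : (n : ℝ)⁻¹ * ((n - l) * c) - c = -(l * c) * (n : ℝ)⁻¹ := by field_simp; ring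
    rw [this, abs_mul, abs_neg, abs_mul, Nat.abs_cast, abs_of_pos (inv_pos.2 hn')]
    gcongr
    exact inv_le_rootRate n
  refine (hb.add hdet).of_le one_pos (Eventually.of_forall fun n ω => ?_)
  simp

end Averages

/-! ### Moments of the observed process -/

section Moments

/-- Each `|z i|` is at most `(∑ |z i|^q)^(1/q)`, so no convexity is needed and any `q > 0` is
allowed. -/
lemma abs_sum_mul_rpow_le {ι : Type*} [Fintype ι] (c z : ι → ℝ) {q : ℝ} (hq : 0 < q) :
    |∑ i, c i * z i| ^ q ≤ (∑ i, |c i|) ^ q * ∑ i, |z i| ^ q := by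
  have hS : 0 ≤ ∑ i, |z i| ^ q := Finset.sum_nonneg fun i _ => by positivity
  have hc : 0 ≤ ∑ i, |c i| := Finset.sum_nonneg fun i _ => abs_nonneg _
  have hz : ∀ i, |z i| ≤ (∑ i, |z i| ^ q) ^ q⁻¹ := fun i => by
    rw [Real.le_rpow_inv_iff_of_pos (abs_nonneg _) hS hq]
    exact Finset.single_le_sum (f := fun i => |z i| ^ q) (fun j _ => by positivity)
      (Finset.mem_univ i)
  have h : |∑ i, c i * z i| ≤ (∑ i, |c i|) * (∑ i, |z i| ^ q) ^ q⁻¹ := by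
    rw [Finset.sum_mul]
    refine (Finset.abs_sum_le_sum_abs _ _).trans (Finset.sum_le_sum fun i _ => ?_)
    rw [abs_mul]
    gcongr
    exact hz i
  calc |∑ i, c i * z i| ^ q ≤ ((∑ i, |c i|) * (∑ i, |z i| ^ q) ^ q⁻¹) ^ q := by gcongr
    _ = _ := by
      rw [Real.mul_rpow hc (by positivity), ← Real.rpow_mul hS, inv_mul_cancel₀ hq.ne',
        Real.rpow_one]

variable {Ω : Type*} [MeasurableSpace Ω] {P : Measure Ω}

/-- A bound on the `[0, ∞]`-valued integral forces integrability; the Bochner integral could be `0`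
by default. -/
lemma integrable_of_lintegral_rpow_lt {X : Ω → ℝ} (hX : Measurable X) {q C : ℝ}
    (hC : 0 < C) (h : ∫⁻ ω, ENNReal.ofReal (|X ω| ^ q) ∂P < ENNReal.ofReal C) :
    Integrable (fun ω => |X ω| ^ q) P ∧ ∫ ω, |X ω| ^ q ∂P ≤ C := by
  have hm : Measurable fun ω => |X ω| ^ q := by fun_prop
  have hnn : 0 ≤ᵐ[P] fun ω => |X ω| ^ q := Eventually.of_forall fun ω => by positivity
  have hi : Integrable (fun ω => |X ω| ^ q) P :=
    ⟨hm.aestronglyMeasurable, by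
      rw [hasFiniteIntegral_iff_ofReal hnn]
      exact h.trans ENNReal.ofReal_lt_top⟩
  refine ⟨hi, ?_⟩
  rw [← ofReal_integral_eq_lintegral_ofReal hi hnn] at h
  exact ((ENNReal.ofReal_lt_ofReal_iff hC).1 h).le

variable {p r v : ℕ} {L₁ : Matrix (Fin p) (Fin r) ℝ} {L₂ : Matrix (Fin p) (Fin v) ℝ}
  {f : ℤ → Ω → Fin r → ℝ} {ε : ℤ → Ω → Fin v → ℝ}

lemma measurable_obs (hf : ∀ t, Measurable (f t)) (hε : ∀ t, Measurable (ε t)) (t : ℤ) :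
    Measurable (obs L₁ L₂ f ε t) := by
  refine measurable_pi_lambda _ fun i => ?_
  have h1 := fun j => (measurable_pi_apply j).comp (hf t)
  have h2 := fun j => (measurable_pi_apply j).comp (hε t)
  simp only [obs, Pi.add_apply, Matrix.mulVec, dotProduct]
  exact (Finset.measurable_fun_sum _ fun j _ => (h1 j).const_mul _).add
    (Finset.measurable_fun_sum _ fun j _ => (h2 j).const_mul _)

lemma exists_moment_bound_obs (hf : ∀ t, Measurable (f t)) (hε : ∀ t, Measurable (ε t))
    {q C₁ C₂ : ℝ} (hq : 0 < q) (hC₁ : 0 < C₁) (hC₂ : 0 < C₂)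
    (hmom_f : ∀ t i, ∫⁻ ω, ENNReal.ofReal (|f t ω i| ^ q) ∂P < ENNReal.ofReal C₁)
    (hmom_ε : ∀ t j, ∫⁻ ω, ENNReal.ofReal (|ε t ω j| ^ q) ∂P < ENNReal.ofReal C₂) (i : Fin p) :
    ∃ M, ∀ t, Integrable (fun ω => |obs L₁ L₂ f ε t ω i| ^ q) P ∧
      ∫ ω, |obs L₁ L₂ f ε t ω i| ^ q ∂P ≤ M := by
  set K := (∑ x, |Sum.elim (L₁ i) (L₂ i) x|) ^ q with hK
  have hK0 : 0 ≤ K := by positivity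
  refine ⟨K * (r * C₁ + v * C₂), fun t => ?_⟩
  have hf' := fun j => integrable_of_lintegral_rpow_lt ((measurable_pi_apply j).comp (hf t)) hC₁
    (hmom_f t j)
  have hε' := fun j => integrable_of_lintegral_rpow_lt ((measurable_pi_apply j).comp (hε t)) hC₂
    (hmom_ε t j)
  simp only [Function.comp_apply] at hf' hε'
  have hfi := integrable_finsetSum Finset.univ fun j _ => (hf' j).1
  have hεi := integrable_finsetSum Finset.univ fun j _ => (hε' j).1
  have hi := (hfi.add hεi).const_mul K
  have hle : ∀ ω, |obs L₁ L₂ f ε t ω i| ^ q ≤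
      K * (∑ j, |f t ω j| ^ q + ∑ j, |ε t ω j| ^ q) := fun ω => by
    have := abs_sum_mul_rpow_le (Sum.elim (L₁ i) (L₂ i)) (Sum.elim (f t ω) (ε t ω)) hq
    rw [← hK] at this
    simp only [Fintype.sum_sum_type, Sum.elim_inl, Sum.elim_inr] at this
    exact this
  have hm : Measurable fun ω => |obs L₁ L₂ f ε t ω i| ^ q := by
    have := (measurable_pi_apply i).comp (measurable_obs (L₁ := L₁) (L₂ := L₂) hf hε t)
    exact this.abs.pow_const q
  refine ⟨hi.mono' hm.aestronglyMeasurable (Eventually.of_forall fun ω => ?_), ?_⟩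
  · rw [Real.norm_eq_abs, abs_of_nonneg (by positivity)]
    exact hle ω
  · calc _ ≤ ∫ ω, K * (∑ j, |f t ω j| ^ q + ∑ j, |ε t ω j| ^ q) ∂P :=
          integral_mono_of_nonneg (Eventually.of_forall fun ω => by positivity) hi
            (Eventually.of_forall hle)
      _ = K * (∑ j, ∫ ω, |f t ω j| ^ q ∂P + ∑ j, ∫ ω, |ε t ω j| ^ q ∂P) := by
          rw [integral_const_mul, integral_add hfi hεi,
            integral_finsetSum _ fun j _ => (hf' j).1, integral_finsetSum _ fun j _ => (hε' j).1]
      _ ≤ _ := by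
          gcongr
          · exact (Finset.sum_le_sum fun j _ => (hf' j).2).trans_eq (by simp)
          · exact (Finset.sum_le_sum fun j _ => (hε' j).2).trans_eq (by simp)

end Moments

/-! ### Convergence of the sample autocovariances -/

section SampleAutocov

open scoped Matrix.Norms.Frobenius

variable {Ω E : Type*} [MeasurableSpace Ω] [MeasurableSpace E] {P : Measure Ω}

lemma rpow_le_one_add_rpow_two_mul {x γ : ℝ} (hx : 0 ≤ x) : x ^ γ ≤ 1 + x ^ (2 * γ) := by
  rw [mul_comm, Real.rpow_mul hx, Real.rpow_two]
  nlinarith [sq_nonneg (x ^ γ - 1)]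

lemma mul_rpow_le_add_rpow_two_mul {x y γ : ℝ} (hx : 0 ≤ x) (hy : 0 ≤ y) :
    (x * y) ^ γ ≤ x ^ (2 * γ) + y ^ (2 * γ) := by
  rw [mul_comm 2 γ, Real.mul_rpow hx hy, Real.rpow_mul hx, Real.rpow_mul hy, Real.rpow_two,
    Real.rpow_two]
  nlinarith [sq_nonneg (x ^ γ - y ^ γ), Real.rpow_nonneg hx γ, Real.rpow_nonneg hy γ]

/-- The moment and mixing conditions on a coordinate of the observed process. -/
structure HasCoordMoments (P : Measure Ω) (Z : ℤ → Ω → E) (γ M : ℝ) (x : ℤ → Ω → ℝ) : Prop where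
  exists_eq : ∃ g : E → ℝ, Measurable g ∧ ∀ t ω, x t ω = g (Z t ω)
  integrable : ∀ t, Integrable (fun ω => |x t ω| ^ (2 * γ)) P
  moment : ∀ t, ∫ ω, |x t ω| ^ (2 * γ) ∂P ≤ M

namespace HasCoordMoments

variable {Z : ℤ → Ω → E} {γ M M' : ℝ} {x y : ℤ → Ω → ℝ}

lemma measurable_past (hx : HasCoordMoments P Z γ M x) {s t : ℤ} (h : t ≤ s) :
    Measurable[pastSigma Z s] (x t) := by
  obtain ⟨g, hg, e⟩ := hx.exists_eq
  rw [show x t = g ∘ Z t from funext (e t)]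
  exact hg.comp (measurable_pastSigma h)

lemma measurable_future (hx : HasCoordMoments P Z γ M x) {s t : ℤ} (h : s ≤ t) :
    Measurable[futureSigma Z s] (x t) := by
  obtain ⟨g, hg, e⟩ := hx.exists_eq
  rw [show x t = g ∘ Z t from funext (e t)]
  exact hg.comp (measurable_futureSigma h)

lemma measurable (hx : HasCoordMoments P Z γ M x) (hZ : ∀ t, Measurable (Z t)) (t : ℤ) :
    Measurable (x t) :=
  (hx.measurable_past le_rfl).mono (pastSigma_le hZ t) le_rfl

lemma isLocalFunctional_shift [IsProbabilityMeasure P] (hx : HasCoordMoments P Z γ M x) (hZ : ∀ t, Measurable (Z t))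
    (k : ℕ) : IsLocalFunctional P Z γ (1 + M) k (fun t => x (t - k)) := by
  have hi : ∀ t, Integrable (fun ω => |x t ω| ^ γ) P := fun t =>
    ((integrable_const 1).add (hx.integrable t)).mono'
      ((hx.measurable hZ t).abs.pow_const γ).aestronglyMeasurable
      (Eventually.of_forall fun ω => by
        rw [Real.norm_eq_abs, abs_of_nonneg (by positivity)]
        exact rpow_le_one_add_rpow_two_mul (abs_nonneg _))
  refine ⟨fun t => hx.measurable_past (by omega), fun t => hx.measurable_future le_rfl,
    fun t => hi _, fun t => ?_⟩
  calc _ ≤ ∫ ω, (1 + |x (t - k) ω| ^ (2 * γ)) ∂P :=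
        integral_mono (hi _) ((integrable_const 1).add (hx.integrable _))
          fun ω => rpow_le_one_add_rpow_two_mul (abs_nonneg _)
    _ ≤ _ := by
        rw [integral_add (integrable_const 1) (hx.integrable _)]
        simpa using hx.moment (t - k)

/-- A `γ`-th moment of a product costs `2γ`-th moments of its factors, which is why the model
assumes moments of order `2γ`. -/
lemma isLocalFunctional_mul (hx : HasCoordMoments P Z γ M x) (hy : HasCoordMoments P Z γ M' y)
    (hZ : ∀ t, Measurable (Z t)) (k : ℕ) :
    IsLocalFunctional P Z γ (M + M') k (fun t ω => x t ω * y (t - k) ω) := by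
  have hle : ∀ t ω, |x t ω * y (t - k) ω| ^ γ ≤
      |x t ω| ^ (2 * γ) + |y (t - k) ω| ^ (2 * γ) := fun t ω => by
    rw [abs_mul]
    exact mul_rpow_le_add_rpow_two_mul (abs_nonneg _) (abs_nonneg _)
  have hi : ∀ t, Integrable (fun ω => |x t ω * y (t - k) ω| ^ γ) P := fun t =>
    ((hx.integrable t).add (hy.integrable (t - k))).mono'
      (((hx.measurable hZ t).mul (hy.measurable hZ _)).abs.pow_const γ).aestronglyMeasurable
      (Eventually.of_forall fun ω => by
        rw [Real.norm_eq_abs, abs_of_nonneg (by positivity)]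
        exact hle t ω)
  refine ⟨fun t => (hx.measurable_past le_rfl).mul (hy.measurable_past (by omega)),
    fun t => (hx.measurable_future (by omega)).mul (hy.measurable_future le_rfl), hi, fun t => ?_⟩
  calc _ ≤ ∫ ω, (|x t ω| ^ (2 * γ) + |y (t - k) ω| ^ (2 * γ)) ∂P :=
        integral_mono (hi _) ((hx.integrable t).add (hy.integrable _)) (hle t)
    _ ≤ _ := by
        rw [integral_add (hx.integrable t) (hy.integrable _)]
        exact add_le_add (hx.moment t) (hy.moment _)

end HasCoordMoments

/-- Only the first term is an average of products; the centring terms contain two averages each. The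
truncated `n - k` counts the summands also when `n < k`. -/
lemma sampleAutocov_apply {p : ℕ} (y : ℤ → Fin p → ℝ) (n k : ℕ) (i j : Fin p) :
    sampleAutocov y n k i j = (n : ℝ)⁻¹ * ∑ t ∈ Finset.Icc (k + 1) n, y t i * y (t - k) j
      - ((n : ℝ)⁻¹ * ∑ t ∈ Finset.Icc (k + 1) n, y t i) * sampleMean y n j
      - ((n : ℝ)⁻¹ * ∑ t ∈ Finset.Icc (k + 1) n, y (t - k) j) * sampleMean y n i
      + (n : ℝ)⁻¹ * (n - k : ℕ) * (sampleMean y n i * sampleMean y n j) := by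
  have h : ∀ t : ℕ, (y t i - sampleMean y n i) * (y (t - k) j - sampleMean y n j) =
      y t i * y (t - k) j - y t i * sampleMean y n j - y (t - k) j * sampleMean y n i +
        sampleMean y n i * sampleMean y n j := fun t => by ring
  simp only [sampleAutocov, Matrix.smul_apply, Matrix.sum_apply, Matrix.vecMulVec_apply,
    Pi.sub_apply, smul_eq_mul, h, Finset.sum_add_distrib, Finset.sum_sub_distrib,
    ← Finset.sum_mul, Finset.sum_const, Nat.card_Icc, Nat.add_sub_add_right, nsmul_eq_mul]
  ring

lemma sampleAutocov_zero_transpose {p : ℕ} (y : ℤ → Fin p → ℝ) (n : ℕ) :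
    (sampleAutocov y n 0)ᵀ = sampleAutocov y n 0 := by
  ext i j
  simp [sampleAutocov, Matrix.sum_apply, Matrix.vecMulVec_apply, mul_comm]

/-- The sample autocovariance matrices converge at the parametric rate. -/
lemma isBigOp_sampleAutocov_sub [IsProbabilityMeasure P] {p : ℕ} {Z : ℤ → Ω → E} (hZ : ∀ t, Measurable (Z t)) {γ : ℝ}
    (hγ : 2 < γ) (hmix : Summable fun k : ℕ => alphaMixing P Z (k + 1) ^ (1 - 2 / γ))
    {y : ℤ → Ω → Fin p → ℝ} {M : Fin p → ℝ}
    (hy : ∀ i, HasCoordMoments P Z γ (M i) (fun t ω => y t ω i))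
    (hmean : ∀ t i, ∫ ω, y t ω i ∂P = 0) {k : ℕ} {S : Matrix (Fin p) (Fin p) ℝ}
    (hS : ∀ (t : ℤ) i j, ∫ ω, y t ω i * y (t - k) ω j ∂P = S i j) :
    IsBigOp P (fun n ω => ‖sampleAutocov (fun t => y t ω) n k - S‖) rootRate := by
  have hmeanO : ∀ i l, IsBigOp P
      (fun n ω => (n : ℝ)⁻¹ * ∑ t ∈ Finset.Icc (l + 1) n, y t ω i) rootRate := fun i l => by
    have := ((hy i).isLocalFunctional_shift hZ 0).isBigOp_average_sub hZ hγ hmix (c := 0)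
      (fun t => hmean _ i) l
    simpa using this
  have hlagO : ∀ i, IsBigOp P
      (fun n ω => (n : ℝ)⁻¹ * ∑ t ∈ Finset.Icc (k + 1) n, y (t - k) ω i) rootRate := fun i => by
    have := ((hy i).isLocalFunctional_shift hZ k).isBigOp_average_sub hZ hγ hmix (c := 0)
      (fun t => hmean _ i) k
    simpa using this
  have hbar : ∀ i, IsBigOp P (fun n ω => sampleMean (fun t => y t ω) n i) rootRate := fun i => by
    have := hmeanO i 0
    simpa [sampleMean, Finset.sum_apply] using this
  have hprod := fun i j => ((hy i).isLocalFunctional_mul (hy j) hZ k).isBigOp_average_sub hZ hγ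
    hmix (fun t => hS t i j) k
  have hentry : ∀ i j, IsBigOp P
      (fun n ω => |(sampleAutocov (fun t => y t ω) n k - S) i j|) rootRate := fun i j => by
    -- Centring terms have two factors of order `n^(-1/2)`; using one of them as `O_p(1)` already
    -- gives the rate.
    have h1 := (hmeanO i k).mul_one_rate (hbar j).rootRate_one
    have h2 := (hlagO j).mul_one_rate (hbar i).rootRate_one
    have h3 := (hbar i).mul_one_rate (hbar j).rootRate_one
    have h4 : IsBigOp P (fun n ω => (n : ℝ)⁻¹ * (n - k : ℕ) *
        (sampleMean (fun t => y t ω) n i * sampleMean (fun t => y t ω) n j)) rootRate := by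
      refine h3.of_le one_pos (Eventually.of_forall fun n ω => ?_)
      rw [abs_mul]
      gcongr
      rw [abs_of_nonneg (by positivity)]
      rcases n.eq_zero_or_pos with rfl | hn
      · simp
      · rw [inv_mul_le_iff₀ (by exact_mod_cast hn), mul_one]
        exact_mod_cast Nat.sub_le n k
    refine (((hprod i j).add h4).add ((h1.add h2).of_le one_pos (X := fun n ω => -_)
      (Eventually.of_forall fun n ω => by rw [abs_neg, one_mul]))).of_le one_pos
        (Eventually.of_forall fun n ω => ?_)
    rw [abs_abs, one_mul, Matrix.sub_apply, sampleAutocov_apply]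
    refine le_of_eq (congr_arg _ ?_)
    ring
  refine (IsBigOp.sum Finset.univ rootRate_nonneg fun i _ =>
    IsBigOp.sum Finset.univ rootRate_nonneg fun j _ => hentry i j).of_le one_pos
      (Eventually.of_forall fun n ω => ?_)
  rw [abs_of_nonneg (norm_nonneg _), one_mul]
  exact (frobenius_norm_le_sum_abs _).trans (le_abs_self _)

end SampleAutocov

/-! ### Second-order structure of the factor model -/

section Model

variable {Ω : Type*} [MeasurableSpace Ω] {P : Measure Ω}

lemma covMatrix_transpose {a b : ℕ} (X : Ω → Fin a → ℝ) (Y : Ω → Fin b → ℝ) :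
    (covMatrix P X Y)ᵀ = covMatrix P Y X := by
  ext i j
  simp [covMatrix, covariance_comm]

lemma covMatrix_mulVec_add_left [IsProbabilityMeasure P] {p r v b : ℕ}
    (L₁ : Matrix (Fin p) (Fin r) ℝ)
    (L₂ : Matrix (Fin p) (Fin v) ℝ) {X : Ω → Fin r → ℝ} {W : Ω → Fin v → ℝ} {Y : Ω → Fin b → ℝ}
    (hX : ∀ i, MemLp (fun ω => X ω i) 2 P) (hW : ∀ i, MemLp (fun ω => W ω i) 2 P)
    (hY : ∀ i, MemLp (fun ω => Y ω i) 2 P) :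
    covMatrix P (fun ω => L₁ *ᵥ X ω + L₂ *ᵥ W ω) Y =
      L₁ * covMatrix P X Y + L₂ * covMatrix P W Y := by
  ext i j
  have h1 : ∀ x, MemLp (fun ω => L₁ i x * X ω x) 2 P := fun x => (hX x).const_mul _
  have h2 : ∀ x, MemLp (fun ω => L₂ i x * W ω x) 2 P := fun x => (hW x).const_mul _
  simp only [covMatrix, Matrix.of_apply, Pi.add_apply, Matrix.mulVec, dotProduct,
    Matrix.add_apply, Matrix.mul_apply]
  rw [show (fun ω => ∑ x, L₁ i x * X ω x + ∑ x, L₂ i x * W ω x) =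
      (fun ω => ∑ x, L₁ i x * X ω x) + fun ω => ∑ x, L₂ i x * W ω x from rfl,
    covariance_add_left (memLp_finsetSum _ fun x _ => h1 x)
    (memLp_finsetSum _ fun x _ => h2 x) (hY j), covariance_fun_sum_left h1 (hY j),
    covariance_fun_sum_left h2 (hY j)]
  simp only [covariance_const_mul_left]

variable {p r v : ℕ} {L₁ : Matrix (Fin p) (Fin r) ℝ} {L₂ : Matrix (Fin p) (Fin v) ℝ}
  {f : ℤ → Ω → Fin r → ℝ} {ε : ℤ → Ω → Fin v → ℝ}

namespace IsFactorModel

lemma memLp_obs (h : IsFactorModel P L₁ L₂ f ε) (t : ℤ) (i : Fin p) : MemLp (fun ω => obs L₁ L₂ f ε t ω i) 2 P := by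
  simp only [obs, Pi.add_apply, Matrix.mulVec, dotProduct]
  exact (memLp_finsetSum _ fun x _ => (h.memLp_f t x).const_mul _).add
    (memLp_finsetSum _ fun x _ => (h.memLp_ε t x).const_mul _)

lemma covMatrix_obs_left [IsProbabilityMeasure P]
    (h : IsFactorModel P L₁ L₂ f ε) {b : ℕ} (t : ℤ) {Y : Ω → Fin b → ℝ}
    (hY : ∀ i, MemLp (fun ω => Y ω i) 2 P) :
    covMatrix P (obs L₁ L₂ f ε t) Y = L₁ * covMatrix P (f t) Y + L₂ * covMatrix P (ε t) Y :=
  covMatrix_mulVec_add_left L₁ L₂ (h.memLp_f t) (h.memLp_ε t) hY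

lemma autocov_zero [IsProbabilityMeasure P]
    (h : IsFactorModel P L₁ L₂ f ε) : autocov P (obs L₁ L₂ f ε) 0 = L₁ * L₁ᵀ + L₂ * L₂ᵀ := by
  have h0 : covMatrix P (f 0) (ε 0) = 0 := by simpa using h.cov_f_ε 0 0
  have e : (0 : ℤ) - ((0 : ℕ) : ℤ) = 0 := by simp
  rw [autocov, e, h.covMatrix_obs_left 0 (h.memLp_obs 0), ← covMatrix_transpose (obs L₁ L₂ f ε 0),
    ← covMatrix_transpose (obs L₁ L₂ f ε 0), h.covMatrix_obs_left 0 (h.memLp_f 0),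
    h.covMatrix_obs_left 0 (h.memLp_ε 0), h.cov_f, h.cov_ε, ← covMatrix_transpose (f 0) (ε 0), h0]
  simp

/-- `y_{-k}` involves only `f_{-k}` and `ε_{-k}`, both uncorrelated with the later noise `ε_0`.
Hence every positive-lag autocovariance has its columns in the span of `L₁`. -/
lemma autocov_of_pos [IsProbabilityMeasure P]
    (h : IsFactorModel P L₁ L₂ f ε) {k : ℕ} (hk : 0 < k) : autocov P (obs L₁ L₂ f ε) k =
    L₁ * covMatrix P (f 0) (obs L₁ L₂ f ε (0 - k)) := by
  have h1 : covMatrix P (f (0 - k)) (ε 0) = 0 := by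
    simpa using h.cov_f_ε (0 - k) k
  have h2 : covMatrix P (ε (0 - k)) (ε 0) = 0 := h.white_noise _ _ (by omega)
  rw [autocov, h.covMatrix_obs_left 0 (h.memLp_obs _),
    ← covMatrix_transpose (obs L₁ L₂ f ε (0 - k)) (ε 0),
    h.covMatrix_obs_left (0 - k) (h.memLp_ε 0), h1, h2]
  simp

lemma integral_obs_mul [IsProbabilityMeasure P]
    (h : IsFactorModel P L₁ L₂ f ε) (t : ℤ) (k : ℕ) (i j : Fin p) :
    ∫ ω, obs L₁ L₂ f ε t ω i * obs L₁ L₂ f ε (t - k) ω j ∂P =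
      autocov P (obs L₁ L₂ f ε) k i j := by
  have := congr_fun₂ (h.stationary t k) i j
  rw [autocov, ← this]
  simp only [covMatrix, Matrix.of_apply]
  rw [covariance_eq_sub (h.memLp_obs t i) (h.memLp_obs (t - k) j), h.mean_obs, zero_mul, sub_zero]
  rfl

lemma proj_mul_lagSum [IsProbabilityMeasure P]
    (h : IsFactorModel P L₁ L₂ f ε) {A₁ : Matrix (Fin p) (Fin r) ℝ} {Q₁ : Matrix (Fin r) (Fin r) ℝ}
    (hL₁ : L₁ = A₁ * Q₁) (hA₁ : A₁ᵀ * A₁ = 1) (k₀ : ℕ) :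
    A₁ * A₁ᵀ * lagSum (autocov P (obs L₁ L₂ f ε)) k₀ =
      lagSum (autocov P (obs L₁ L₂ f ε)) k₀ := by
  rw [lagSum, Finset.mul_sum]
  refine Finset.sum_congr rfl fun k hk => ?_
  have hA : A₁ * A₁ᵀ * L₁ = L₁ := by
    rw [hL₁, ← Matrix.mul_assoc, Matrix.mul_assoc A₁, hA₁, Matrix.mul_one]
  rw [← Matrix.mul_assoc]
  congr 1
  rw [h.autocov_of_pos (Finset.mem_Icc.1 hk).1, ← Matrix.mul_assoc, hA]

end IsFactorModel

end Model

/-! ### Perturbation of `M` and of the second-step matrix -/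

section Perturbation

open scoped Matrix.Norms.Frobenius

variable {p v : ℕ}

lemma norm_mul_transpose_sub_le (S S' : Matrix (Fin p) (Fin p) ℝ) :
    ‖S' * S'ᵀ - S * Sᵀ‖ ≤ ‖S' - S‖ * (‖S' - S‖ + 2 * ‖S‖) := by
  have e : S' * S'ᵀ - S * Sᵀ =
      (S' - S) * (S' - S)ᵀ + (S' - S) * Sᵀ + S * (S' - S)ᵀ := by
    simp only [Matrix.transpose_sub, sub_mul, mul_sub]
    abel
  rw [e]
  calc _ ≤ ‖S' - S‖ * ‖(S' - S)ᵀ‖ + ‖S' - S‖ * ‖Sᵀ‖ + ‖S‖ * ‖(S' - S)ᵀ‖ :=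
        (norm_add_le _ _).trans (add_le_add ((norm_add_le _ _).trans (add_le_add
          (Matrix.frobenius_norm_mul _ _) (Matrix.frobenius_norm_mul _ _)))
          (Matrix.frobenius_norm_mul _ _))
    _ = _ := by rw [Matrix.frobenius_norm_transpose, Matrix.frobenius_norm_transpose]; ring

lemma norm_lagSum_sub_le (Γ Γ' : ℕ → Matrix (Fin p) (Fin p) ℝ) (k₀ : ℕ) :
    ‖lagSum Γ' k₀ - lagSum Γ k₀‖ ≤
      ∑ k ∈ Finset.Icc 1 k₀, ‖Γ' k - Γ k‖ * (‖Γ' k - Γ k‖ + 2 * ‖Γ k‖) := by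
  rw [lagSum, lagSum, ← Finset.sum_sub_distrib]
  exact (norm_sum_le _ _).trans (Finset.sum_le_sum fun k _ => norm_mul_transpose_sub_le _ _)

/-- Only `B Bᵀ` enters `projPCA`, so the error of the first step appears through projections alone,
whatever basis was chosen. -/
lemma norm_projPCA_sub_le (S S' : Matrix (Fin p) (Fin p) ℝ) {B B' : Matrix (Fin p) (Fin v) ℝ}
    (hB : Bᵀ * B = 1) (hB' : B'ᵀ * B' = 1) :
    ‖projPCA S' B' - projPCA S B‖ ≤ (‖S' - S‖ + ‖B' * B'ᵀ - B * Bᵀ‖) *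
      ((v + ‖S‖) * (‖S' - S‖ + 2 * ‖S‖)) := by
  have e : projPCA S' B' - projPCA S B = (S' - S) * (B' * B'ᵀ) * (S' - S)
      + (S' - S) * (B' * B'ᵀ) * S + S * (B' * B'ᵀ - B * Bᵀ) * (S' - S)
      + S * (B' * B'ᵀ - B * Bᵀ) * S + S * (B * Bᵀ) * (S' - S) := by
    simp only [projPCA, sub_mul, mul_sub, ← Matrix.mul_assoc]
    abel
  have tri : ∀ X Y Z : Matrix (Fin p) (Fin p) ℝ, ‖X * Y * Z‖ ≤ ‖X‖ * ‖Y‖ * ‖Z‖ := fun X Y Z =>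
    (Matrix.frobenius_norm_mul _ _).trans
      (mul_le_mul_of_nonneg_right (Matrix.frobenius_norm_mul _ _) (norm_nonneg _))
  have hP := norm_mul_transpose_le hB
  have hP' := norm_mul_transpose_le hB'
  rw [e]
  have t1 := tri (S' - S) (B' * B'ᵀ) (S' - S)
  have t2 := tri (S' - S) (B' * B'ᵀ) S
  have t3 := tri S (B' * B'ᵀ - B * Bᵀ) (S' - S)
  have t4 := tri S (B' * B'ᵀ - B * Bᵀ) S
  have t5 := tri S (B * Bᵀ) (S' - S)
  generalize (S' - S) * (B' * B'ᵀ) * (S' - S) = X₁ at *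
  generalize (S' - S) * (B' * B'ᵀ) * S = X₂ at *
  generalize S * (B' * B'ᵀ - B * Bᵀ) * (S' - S) = X₃ at *
  generalize S * (B' * B'ᵀ - B * Bᵀ) * S = X₄ at *
  generalize S * (B * Bᵀ) * (S' - S) = X₅ at *
  have n1 := norm_add_le X₁ X₂
  have n2 := norm_add_le (X₁ + X₂) X₃
  have n3 := norm_add_le (X₁ + X₂ + X₃) X₄
  have n4 := norm_add_le (X₁ + X₂ + X₃ + X₄) X₅
  have hd0 : 0 ≤ ‖S' - S‖ := norm_nonneg _
  have hs0 : 0 ≤ ‖S‖ := norm_nonneg _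
  have hq0 : 0 ≤ ‖B' * B'ᵀ - B * Bᵀ‖ := norm_nonneg _
  generalize ‖S' - S‖ = d at *
  generalize ‖S‖ = s at *
  generalize ‖B' * B'ᵀ - B * Bᵀ‖ = q at *
  have u1 : d * ‖B' * B'ᵀ‖ * d ≤ d * v * d := by gcongr
  have u2 : d * ‖B' * B'ᵀ‖ * s ≤ d * v * s := by gcongr
  have u5 : s * ‖B * Bᵀ‖ * d ≤ s * v * d := by gcongr
  have h0 : 0 ≤ d * d * s + 2 * (d * s * s) + q * v * d + 2 * (q * v * s) + q * s * s := by
    positivity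
  -- The convenient factored bound exceeds the five terms needed by a nonnegative remainder.
  have h1 : (d + q) * ((v + s) * (d + 2 * s)) =
      d * v * d + d * v * s + s * q * d + s * q * s + s * v * d +
        (d * d * s + 2 * (d * s * s) + q * v * d + 2 * (q * v * s) + q * s * s) := by ring
  rw [h1]
  linarith

lemma vecNorm₂_le_sum_abs (u : Fin p → ℝ) : vecNorm₂ u ≤ ∑ i, |u i| := by
  rw [vecNorm₂, Real.sqrt_le_left (Finset.sum_nonneg fun i _ => abs_nonneg _)]
  refine le_trans (le_of_eq ?_) (Finset.sum_sq_le_sq_sum_of_nonneg fun i _ => abs_nonneg _)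
  simp

end Perturbation

/-! ### Population identities for the second step and the common component -/

section

variable {p r v : ℕ}

/-- The population matrix of the projected principal component analysis has a left
pseudo-inverse. -/
lemma exists_mul_projPCA_eq {L₁ A₁ : Matrix (Fin p) (Fin r) ℝ} {Q₁ : Matrix (Fin r) (Fin r) ℝ}
    {L₂ A₂ B₁ : Matrix (Fin p) (Fin v) ℝ} {Q₂ : Matrix (Fin v) (Fin v) ℝ}
    (hL₁ : L₁ = A₁ * Q₁) (hL₂ : L₂ = A₂ * Q₂) (hA₂ : A₂ᵀ * A₂ = 1) (hB₁A₁ : B₁ᵀ * A₁ = 0)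
    (hQ₂ : IsUnit Q₂.det) (hu : IsUnit (B₁ᵀ * A₂).det) :
    A₂ * A₂ᵀ * projPCA (L₁ * L₁ᵀ + L₂ * L₂ᵀ) B₁ = projPCA (L₁ * L₁ᵀ + L₂ * L₂ᵀ) B₁ ∧
      ∃ J, J * projPCA (L₁ * L₁ᵀ + L₂ * L₂ᵀ) B₁ = A₂ * A₂ᵀ := by
  have hsymm : (L₁ * L₁ᵀ + L₂ * L₂ᵀ)ᵀ = L₁ * L₁ᵀ + L₂ * L₂ᵀ := by simp
  have hA₁B₁ : A₁ᵀ * B₁ = 0 := by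
    rw [← Matrix.transpose_transpose B₁, ← Matrix.transpose_mul, hB₁A₁, Matrix.transpose_zero]
  set G := Q₂ * Q₂ᵀ * (A₂ᵀ * B₁) with hG
  -- `B₁` annihilates the factor part of `Σ_y(0)`; what remains is `A₂` times the invertible `G`, so
  -- the range is the span of `A₂`.
  have e : (L₁ * L₁ᵀ + L₂ * L₂ᵀ) * B₁ = A₂ * G := by
    rw [Matrix.add_mul, hL₁, hL₂, hG]
    simp only [Matrix.transpose_mul, Matrix.mul_assoc, hA₁B₁, Matrix.mul_zero, zero_add]
  have e' : projPCA (L₁ * L₁ᵀ + L₂ * L₂ᵀ) B₁ = A₂ * (G * Gᵀ * A₂ᵀ) := by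
    rw [projPCA_eq hsymm, e, Matrix.transpose_mul]
    simp only [Matrix.mul_assoc]
  have hGu : IsUnit (G * Gᵀ).det := by
    have h1 : IsUnit (A₂ᵀ * B₁).det := by
      rw [← Matrix.det_transpose]
      simpa using hu
    have h2 : IsUnit G.det := by
      rw [hG, Matrix.det_mul, Matrix.det_mul, Matrix.det_transpose]
      exact (hQ₂.mul hQ₂).mul h1
    rw [Matrix.det_mul, Matrix.det_transpose]
    exact h2.mul h2
  refine ⟨?_, A₂ * (G * Gᵀ)⁻¹ * A₂ᵀ, ?_⟩
  · rw [e', Matrix.mul_assoc, ← Matrix.mul_assoc A₂ᵀ, hA₂, Matrix.one_mul]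
  · rw [e', Matrix.mul_assoc, ← Matrix.mul_assoc A₂ᵀ, hA₂, Matrix.one_mul, Matrix.mul_assoc,
      ← Matrix.mul_assoc _ (G * Gᵀ), Matrix.nonsing_inv_mul _ hGu, Matrix.one_mul]

/-- In the population, the oblique projection recovers the common component. -/
lemma obliqueProj_mulVec_obs {Ω : Type*} {A₁ B₂ : Matrix (Fin p) (Fin r) ℝ}
    {Q₁ : Matrix (Fin r) (Fin r) ℝ} {A₂ : Matrix (Fin p) (Fin v) ℝ} {Q₂ : Matrix (Fin v) (Fin v) ℝ}
    (hB₂A₂ : B₂ᵀ * A₂ = 0) (hu : IsUnit (B₂ᵀ * A₁).det) (f : ℤ → Ω → Fin r → ℝ)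
    (ε : ℤ → Ω → Fin v → ℝ) (t : ℤ) (ω : Ω) :
    obliqueProj A₁ B₂ *ᵥ obs (A₁ * Q₁) (A₂ * Q₂) f ε t ω = A₁ *ᵥ (Q₁ *ᵥ f t ω) := by
  have h1 : obliqueProj A₁ B₂ * (A₁ * Q₁) = A₁ * Q₁ := by
    rw [obliqueProj, Matrix.mul_assoc, ← Matrix.mul_assoc B₂ᵀ, Matrix.mul_assoc A₁,
      ← Matrix.mul_assoc _ (B₂ᵀ * A₁), Matrix.nonsing_inv_mul _ hu, Matrix.one_mul]
  have h2 : obliqueProj A₁ B₂ * (A₂ * Q₂) = 0 := by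
    rw [obliqueProj, Matrix.mul_assoc, ← Matrix.mul_assoc B₂ᵀ, hB₂A₂, Matrix.zero_mul,
      Matrix.mul_zero]
  rw [obs, Matrix.mulVec_add, Matrix.mulVec_mulVec, Matrix.mulVec_mulVec, h1, h2,
    Matrix.zero_mulVec, add_zero, Matrix.mulVec_mulVec]

/-- The eigenvalues of a split of a positive semidefinite matrix of full rank on the span of
`A`. -/
lemma eigenvalues_of_pseudoInverse {S J : Matrix (Fin p) (Fin p) ℝ}
    {A : Matrix (Fin p) (Fin r) ℝ} {B : Matrix (Fin p) (Fin v) ℝ} (hS : S.PosSemidef)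
    (hA : Aᵀ * A = 1) (hB : Bᵀ * B = 1) (hAB : Aᵀ * B = 0) (hSA : S * (A * Aᵀ) = S)
    (hJ : J * S = A * Aᵀ) {lam : Fin r → ℝ} {mu : Fin v → ℝ}
    (h1 : S * A = A * Matrix.diagonal lam) (h2 : S * B = B * Matrix.diagonal mu) :
    (∀ i, 0 < lam i) ∧ ∀ j, mu j = 0 := by
  have hlam : Aᵀ * S * A = Matrix.diagonal lam := by
    rw [Matrix.mul_assoc, h1, ← Matrix.mul_assoc, hA, Matrix.one_mul]
  have hpsd : (Matrix.diagonal lam).PosSemidef := by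
    have := hS.conjTranspose_mul_mul_same A
    rwa [Matrix.conjTranspose_eq_transpose_of_trivial, hlam] at this
  refine ⟨fun i => lt_of_le_of_ne (by simpa using hpsd.diag_nonneg (i := i)) fun h0 => ?_,
    fun j => ?_⟩
  -- The pseudo-inverse makes `diagonal lam` invertible, so no `lam i` vanishes.
  · have e : Aᵀ * J * A * Matrix.diagonal lam = 1 := by
      rw [Matrix.mul_assoc, ← h1, Matrix.mul_assoc, ← Matrix.mul_assoc J, hJ, Matrix.mul_assoc A,
        hA, Matrix.mul_one, hA]
    have := congr_fun₂ e i i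
    rw [Matrix.mul_diagonal, ← h0, mul_zero, Matrix.one_apply_eq] at this
    exact zero_ne_one this
  · have e : Matrix.diagonal mu = 0 := by
      rw [← Matrix.one_mul (Matrix.diagonal mu), ← hB, Matrix.mul_assoc, ← h2, ← hSA,
        Matrix.mul_assoc, Matrix.mul_assoc A, hAB]
      simp
    simpa using congr_fun₂ e j j

end

/-! ### Assembly: from autocovariance rates to the estimators -/

open scoped Matrix.Norms.Frobenius in
/-- The rates of the estimators, given the rate of the sample autocovariance matrices. -/
theorem isBigOp_estimators_of_sampleAutocov
    {Ω : Type*} [MeasurableSpace Ω] (P : Measure Ω) [IsProbabilityMeasure P]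
    {p r v : ℕ} (hr : 0 < r) (hv : 0 < v) (hp : r + v = p) (k₀ : ℕ)
    (L₁ : Matrix (Fin p) (Fin r) ℝ) (L₂ : Matrix (Fin p) (Fin v) ℝ)
    (f : ℤ → Ω → Fin r → ℝ) (ε : ℤ → Ω → Fin v → ℝ)
    (hmodel : IsFactorModel P L₁ L₂ f ε)
    (hrank : (lagSum (autocov P (obs L₁ L₂ f ε)) k₀).rank = r)
    (A₁ : Matrix (Fin p) (Fin r) ℝ) (Q₁ : Matrix (Fin r) (Fin r) ℝ)
    (A₂ : Matrix (Fin p) (Fin v) ℝ) (Q₂ : Matrix (Fin v) (Fin v) ℝ)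
    (hL₁ : L₁ = A₁ * Q₁) (hA₁ : A₁ᵀ * A₁ = 1) (hL₂ : L₂ = A₂ * Q₂) (hA₂ : A₂ᵀ * A₂ = 1)
    (B₁ : Matrix (Fin p) (Fin v) ℝ) (B₂ : Matrix (Fin p) (Fin r) ℝ)
    (hB₁ : B₁ᵀ * B₁ = 1) (hB₁A₁ : B₁ᵀ * A₁ = 0) (hB₂ : B₂ᵀ * B₂ = 1) (hB₂A₂ : B₂ᵀ * A₂ = 0)
    (A₁hat : ℕ → Ω → Matrix (Fin p) (Fin r) ℝ) (B₁hat : ℕ → Ω → Matrix (Fin p) (Fin v) ℝ)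
    (B₂hat : ℕ → Ω → Matrix (Fin p) (Fin r) ℝ)
    (hG : ∀ n ω, IsSpectralSplit
      (lagSum (sampleAutocov (fun t => obs L₁ L₂ f ε t ω) n) k₀) (A₁hat n ω) (B₁hat n ω))
    (hB₂hat : ∀ n ω, ∃ U : Matrix (Fin p) (Fin v) ℝ, IsSpectralSplit
      (projPCA (sampleAutocov (fun t => obs L₁ L₂ f ε t ω) n 0) (B₁hat n ω)) U (B₂hat n ω))
    (hΔ : ∀ k, IsBigOp P (fun n ω => ‖sampleAutocov (fun t => obs L₁ L₂ f ε t ω) n k -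
      autocov P (obs L₁ L₂ f ε) k‖) rootRate) :
    IsBigOp P (fun n ω => discrepancy (A₁hat n ω) A₁) rootRate ∧
    IsBigOp P (fun n ω => discrepancy (B₁hat n ω) B₁) rootRate ∧
    IsBigOp P (fun n ω => discrepancy (B₂hat n ω) B₂) rootRate ∧
    (HasDistinctEigenvalues (lagSum_isHermitian (autocov P (obs L₁ L₂ f ε)) k₀) r →
      IsSpectralSplit (lagSum (autocov P (obs L₁ L₂ f ε)) k₀) A₁ B₁ →
      ∃ s : ℕ → Ω → Fin r → ℝ, (∀ n ω j, s n ω j = 1 ∨ s n ω j = -1) ∧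
        IsBigOp P (fun n ω => matNorm₂ (A₁hat n ω * Matrix.diagonal (s n ω) - A₁)) rootRate) ∧
    (∀ τ : ℕ → ℤ,
      IsBigOp P (fun n ω => vecNorm₂
          (A₁hat n ω *ᵥ recoveredFactor (A₁hat n ω) (B₂hat n ω) (obs L₁ L₂ f ε (τ n) ω) -
            A₁ *ᵥ (Q₁ *ᵥ f (τ n) ω))) rootRate) := by
  obtain ⟨-, hQ₂u, hBAu, hB₁A₂u⟩ := exists_inverses_of_full_rank hp hB₁ hB₁A₁ hB₂ hB₂A₂
    (by rw [← hL₁, ← hL₂]; exact hmodel.full_rank)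
  have hA₁B₁ : A₁ᵀ * B₁ = 0 := by
    rw [← Matrix.transpose_transpose B₁, ← Matrix.transpose_mul, hB₁A₁, Matrix.transpose_zero]
  have hA₂B₂ : A₂ᵀ * B₂ = 0 := by
    rw [← Matrix.transpose_transpose B₂, ← Matrix.transpose_mul, hB₂A₂, Matrix.transpose_zero]
  have hsum₁ := mul_transpose_add_mul_transpose hp hA₁ hB₁ hA₁B₁
  have hsum₂ := mul_transpose_add_mul_transpose (by omega) hA₂ hB₂ hA₂B₂
  have hlagT : ∀ Γ : ℕ → Matrix (Fin p) (Fin p) ℝ, (lagSum Γ k₀)ᵀ = lagSum Γ k₀ := fun Γ => by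
    rw [← Matrix.conjTranspose_eq_transpose_of_trivial]
    exact lagSum_isHermitian Γ k₀
  set Γy := autocov P (obs L₁ L₂ f ε) with hΓy
  set Γhat := fun n ω => sampleAutocov (fun t => obs L₁ L₂ f ε t ω) n with hΓhat
  have hAM := hmodel.proj_mul_lagSum hL₁ hA₁ k₀
  have hMA : lagSum Γy k₀ * (A₁ * A₁ᵀ) = lagSum Γy k₀ := by
    have := congr_arg Matrix.transpose hAM
    rwa [Matrix.transpose_mul, hlagT, (isOrthProj_mul_transpose hA₁).symm] at this
  -- The rank condition on `M` enters here: it makes the range of `M` all of the span of `A₁`.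
  obtain ⟨J₁, hJ₁⟩ := exists_mul_eq_of_rank (hlagT _) hAM hrank
  obtain ⟨c₁, hc₁, hbound₁⟩ := exists_norm_sub_le_of_posSemidef (lagSum_posSemidef Γy k₀) hA₁
    hAM hJ₁
  have hΔM : IsBigOp P (fun n ω => ‖lagSum (Γhat n ω) k₀ - lagSum Γy k₀‖) rootRate := by
    refine (IsBigOp.sum (Finset.Icc 1 k₀) rootRate_nonneg fun k _ =>
      (hΔ k).mul_one_rate ((hΔ k).rootRate_one.add (isBigOp_const (2 * ‖Γy k‖)))).of_le one_pos
        (Eventually.of_forall fun n ω => ?_)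
    rw [abs_norm, one_mul]
    exact (norm_lagSum_sub_le _ _ _).trans (le_abs_self _)
  have hPA : IsBigOp P (fun n ω => ‖A₁hat n ω * (A₁hat n ω)ᵀ - A₁ * A₁ᵀ‖) rootRate :=
    hΔM.of_le hc₁ (Eventually.of_forall fun n ω => by
      rw [abs_norm, abs_norm]
      exact hbound₁ v _ _ _ (hlagT _) (hG n ω))
  have hPB₁ : IsBigOp P (fun n ω => ‖B₁hat n ω * (B₁hat n ω)ᵀ - B₁ * B₁ᵀ‖) rootRate := by
    convert hPA using 3 with n ω
    exact norm_compl_sub_eq (hG n ω).add_eq_one hsum₁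
  obtain ⟨hAS, J₂, hJ₂⟩ := exists_mul_projPCA_eq hL₁ hL₂ hA₂ hB₁A₁ hQ₂u hB₁A₂u
  rw [← hmodel.autocov_zero, ← hΓy] at hAS hJ₂
  have hΓ0T : (Γy 0)ᵀ = Γy 0 := by
    rw [hΓy, hmodel.autocov_zero]; simp
  obtain ⟨c₂, hc₂, hbound₂⟩ := exists_norm_sub_le_of_posSemidef (projPCA_posSemidef hΓ0T B₁) hA₂
    hAS hJ₂
  have hΔS : IsBigOp P (fun n ω => ‖projPCA (Γhat n ω 0) (B₁hat n ω) - projPCA (Γy 0) B₁‖)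
      rootRate := by
    refine (((hΔ 0).add hPB₁).mul_one_rate (((isBigOp_const (v + ‖Γy 0‖)).mul
      ((hΔ 0).rootRate_one.add (isBigOp_const (2 * ‖Γy 0‖))) fun _ => zero_le_one).mono_rate
        (b := fun _ => 1) (by simp))).of_le one_pos
        (Eventually.of_forall fun n ω => ?_)
    rw [abs_norm, one_mul]
    exact (norm_projPCA_sub_le _ _ hB₁ (hG n ω).2.2.1).trans (le_abs_self _)
  have hPB₂ : IsBigOp P (fun n ω => ‖B₂hat n ω * (B₂hat n ω)ᵀ - B₂ * B₂ᵀ‖) rootRate :=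
    hΔS.of_le hc₂ (Eventually.of_forall fun n ω => by
      obtain ⟨U, hU⟩ := hB₂hat n ω
      -- `B̂₂` belongs to the smallest eigenvalues; its error equals that of the complementary `U`,
      -- which estimates the span of `A₂`.
      rw [abs_norm, abs_norm, norm_compl_sub_eq hU.add_eq_one hsum₂]
      refine hbound₂ r _ _ _ ?_ hU
      rw [← Matrix.conjTranspose_eq_transpose_of_trivial]
      exact (projPCA_posSemidef (sampleAutocov_zero_transpose _ n) _).1)
  have hB₂o : ∀ n ω, (B₂hat n ω)ᵀ * B₂hat n ω = 1 := fun n ω => by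
    obtain ⟨U, hU⟩ := hB₂hat n ω
    exact hU.2.2.1
  refine ⟨?_, ?_, ?_, ?_, ?_⟩
  · refine hPA.of_le one_pos (Eventually.of_forall fun n ω => ?_)
    rw [abs_norm, one_mul]
    exact discrepancy_le hr (hG n ω).2.1 hA₁
  · refine hPB₁.of_le one_pos (Eventually.of_forall fun n ω => ?_)
    rw [abs_norm, one_mul]
    exact discrepancy_le hv (hG n ω).2.2.1 hB₁
  · refine hPB₂.of_le one_pos (Eventually.of_forall fun n ω => ?_)
    rw [abs_norm, one_mul]
    exact discrepancy_le hr (hB₂o n ω) hB₂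
  · rintro hdist ⟨-, -, -, -, lam, mu, h1, h2, h3, -⟩
    obtain ⟨hlam, hmu⟩ := eigenvalues_of_pseudoInverse (lagSum_posSemidef Γy k₀) hA₁ hB₁ hA₁B₁ hMA
      hJ₁ h1 h2
    have hanti := hdist.strictAnti hp hA₁ hB₁ hA₁B₁ h1 h2 h3 fun i => (hlam i).ne'
    obtain ⟨c, hc, hb⟩ := exists_matNorm₂_sub_le (hlagT Γy) hp hA₁ hB₁ hA₁B₁ h1 h2 hanti
      fun i j => by rw [hmu j]; exact hlam i
    refine ⟨fun n ω j => if 0 ≤ (fun i => A₁hat n ω i j) ⬝ᵥ (fun i => A₁ i j) then 1 else -1,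
      fun n ω j => ite_eq_or_eq _ _ _, ?_⟩
    refine hΔM.of_le hc (Eventually.of_forall fun n ω => ?_)
    rw [abs_norm, abs_of_nonneg (matNorm₂_nonneg _)]
    exact hb _ _ _ (hlagT _) (hG n ω)
  · intro τ
    obtain ⟨J, hJ⟩ := exists_mul_transferMatrix_eq_one hB₂ hsum₁ (by rw [add_comm]; exact hsum₂)
      hA₂ hA₂B₂ (Matrix.nonsing_inv_mul _ hBAu) (Matrix.nonsing_inv_mul (A₂ᵀ * B₁)
        (by rw [← Matrix.det_transpose]; simpa using hB₁A₂u))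
    obtain ⟨c, C, hc, hC, hb⟩ := exists_norm_obliqueProj_sub_le hB₂ hBAu hJ
    have hy : IsBigOp P (fun n ω => vecNorm₂ (obs L₁ L₂ f ε (τ n) ω)) fun _ => 1 := by
      have hcoord : ∀ i, IsBigOp P (fun n ω => |obs L₁ L₂ f ε (τ n) ω i|) fun _ => 1 := fun i => by
        -- By stationarity the variance is the same at all times, so Chebyshev is uniform in `t` and
        -- the times `τ n` may be arbitrary.
        have hvar : ∀ t, Var[fun ω => obs L₁ L₂ f ε t ω i; P] = Γy 0 i i := fun t => by
          rw [← covariance_self (hmodel.memLp_obs t i).aestronglyMeasurable.aemeasurable,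
            covariance_eq_sub (hmodel.memLp_obs t i) (hmodel.memLp_obs t i), hmodel.mean_obs,
            mul_zero, sub_zero, hΓy, ← hmodel.integral_obs_mul t 0 i i]
          simp
        refine (isBigOp_of_variance_le (C := Γy 0 i i) (a := fun _ => 1) (by simp)
          (fun n => hmodel.memLp_obs (τ n) i) (by simp [hvar])).of_le one_pos
            (Eventually.of_forall fun n ω => ?_)
        rw [hmodel.mean_obs, sub_zero, abs_abs, one_mul]
      refine (IsBigOp.sum Finset.univ (fun _ => zero_le_one) fun i _ => hcoord i).of_le one_pos
        (Eventually.of_forall fun n ω => ?_)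
      rw [one_mul, abs_of_nonneg (by unfold vecNorm₂; positivity)]
      exact (vecNorm₂_le_sum_abs _).trans (le_abs_self _)
    have hCe : IsBigOp P (fun n ω => C * (‖A₁hat n ω * (A₁hat n ω)ᵀ - A₁ * A₁ᵀ‖ +
        ‖B₂hat n ω * (B₂hat n ω)ᵀ - B₂ * B₂ᵀ‖)) rootRate :=
      (hPA.add hPB₂).of_le hC (Eventually.of_forall fun n ω => by rw [abs_mul, abs_of_pos hC])
    -- Samples where `B̂₂ᵀ Â₁` is singular, whose inverse is `0` by default, lie outside the event
    -- on which the bound is needed.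
    refine (hPA.add hPB₂).of_le_of_small tendsto_rootRate hc (hCe.mul_one_rate hy) fun n ω he => ?_
    rw [abs_of_nonneg (by positivity)] at he
    have hvn : ∀ u : Fin p → ℝ, 0 ≤ vecNorm₂ u := fun u => Real.sqrt_nonneg _
    rw [mulVec_recoveredFactor, ← obliqueProj_mulVec_obs (Q₁ := Q₁) (Q₂ := Q₂) hB₂A₂ hBAu f ε,
      ← hL₁, ← hL₂, ← Matrix.sub_mulVec, abs_of_nonneg (hvn _)]
    refine (vecNorm₂_mulVec_le _ _).trans (le_trans ?_ (le_abs_self _))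
    exact mul_le_mul_of_nonneg_right (hb _ _ (hG n ω).2.1 (hB₂o n ω) he) (hvn _)

end TSFactor

theorem theorem1
    {Ω : Type*} [MeasurableSpace Ω] (P : Measure Ω) [IsProbabilityMeasure P]
    -- dimensions and the number of lags
    {p r v : ℕ} (hr : 0 < r) (hv : 0 < v) (hp : r + v = p) (k₀ : ℕ) (hk₀ : 0 < k₀)
    -- the model
    (L₁ : Matrix (Fin p) (Fin r) ℝ) (L₂ : Matrix (Fin p) (Fin v) ℝ)
    (f : ℤ → Ω → Fin r → ℝ) (ε : ℤ → Ω → Fin v → ℝ)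
    (hmodel : IsFactorModel P L₁ L₂ f ε)
    -- `M` has exactly `r` nonzero eigenvalues
    (hrank : (lagSum (autocov P (obs L₁ L₂ f ε)) k₀).rank = r)
    -- `L₁ = A₁ Q₁`, `L₂ = A₂ Q₂`, and the orthonormal complements `B₁`, `B₂` of `A₁`, `A₂`
    (A₁ : Matrix (Fin p) (Fin r) ℝ) (Q₁ : Matrix (Fin r) (Fin r) ℝ)
    (A₂ : Matrix (Fin p) (Fin v) ℝ) (Q₂ : Matrix (Fin v) (Fin v) ℝ)
    (hL₁ : L₁ = A₁ * Q₁) (hA₁ : A₁ᵀ * A₁ = 1) (hL₂ : L₂ = A₂ * Q₂) (hA₂ : A₂ᵀ * A₂ = 1)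
    (B₁ : Matrix (Fin p) (Fin v) ℝ) (B₂ : Matrix (Fin p) (Fin r) ℝ)
    (hB₁ : B₁ᵀ * B₁ = 1) (hB₁A₁ : B₁ᵀ * A₁ = 0) (hB₂ : B₂ᵀ * B₂ = 1) (hB₂A₂ : B₂ᵀ * A₂ = 0)
    -- α-mixing and moments
    (γ : ℝ) (hγ : 2 < γ)
    (hmix : Summable fun k : ℕ =>
      alphaMixing P (fun t ω => (obs L₁ L₂ f ε t ω, f t ω)) (k + 1) ^ (1 - 2 / γ))
    (C₁ C₂ : ℝ) (hC₁ : 0 < C₁) (hC₂ : 0 < C₂)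
    (hmom_f : ∀ t i, ∫⁻ ω, ENNReal.ofReal (|f t ω i| ^ (2 * γ)) ∂P < ENNReal.ofReal C₁)
    (hmom_ε : ∀ t j, ∫⁻ ω, ENNReal.ofReal (|ε t ω j| ^ (2 * γ)) ∂P < ENNReal.ofReal C₂)
    -- the estimators computed from `y 1, ..., y n` (any choice of the eigenvectors)
    (A₁hat : ℕ → Ω → Matrix (Fin p) (Fin r) ℝ) (B₁hat : ℕ → Ω → Matrix (Fin p) (Fin v) ℝ)
    (B₂hat : ℕ → Ω → Matrix (Fin p) (Fin r) ℝ)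
    (hG : ∀ n ω, IsSpectralSplit
      (lagSum (sampleAutocov (fun t => obs L₁ L₂ f ε t ω) n) k₀) (A₁hat n ω) (B₁hat n ω))
    (hB₂hat : ∀ n ω, ∃ U : Matrix (Fin p) (Fin v) ℝ, IsSpectralSplit
      (projPCA (sampleAutocov (fun t => obs L₁ L₂ f ε t ω) n 0) (B₁hat n ω)) U (B₂hat n ω)) :
    -- the loading spaces
    IsBigOp P (fun n ω => discrepancy (A₁hat n ω) A₁) (fun n => (n : ℝ) ^ (-(1 / 2) : ℝ)) ∧
    IsBigOp P (fun n ω => discrepancy (B₁hat n ω) B₁) (fun n => (n : ℝ) ^ (-(1 / 2) : ℝ)) ∧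
    IsBigOp P (fun n ω => discrepancy (B₂hat n ω) B₂) (fun n => (n : ℝ) ^ (-(1 / 2) : ℝ)) ∧
    -- the loading matrix, when the nonzero eigenvalues of `M` are distinct and `A₁` is the matrix of
    -- the corresponding eigenvectors; eigenvectors are determined up to their signs `s`
    (HasDistinctEigenvalues (lagSum_isHermitian (autocov P (obs L₁ L₂ f ε)) k₀) r →
      IsSpectralSplit (lagSum (autocov P (obs L₁ L₂ f ε)) k₀) A₁ B₁ →
      ∃ s : ℕ → Ω → Fin r → ℝ, (∀ n ω j, s n ω j = 1 ∨ s n ω j = -1) ∧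
        IsBigOp P (fun n ω => matNorm₂ (A₁hat n ω * Matrix.diagonal (s n ω) - A₁))
          (fun n => (n : ℝ) ^ (-(1 / 2) : ℝ))) ∧
    -- the common component `A₁ x_t`, `x_t = Q₁ f_t`, at times `τ n` that may vary with `n`
    (∀ τ : ℕ → ℤ,
      IsBigOp P (fun n ω => vecNorm₂
          (A₁hat n ω *ᵥ recoveredFactor (A₁hat n ω) (B₂hat n ω) (obs L₁ L₂ f ε (τ n) ω) -
            A₁ *ᵥ (Q₁ *ᵥ f (τ n) ω)))
        (fun n => (n : ℝ) ^ (-(1 / 2) : ℝ))) := by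
  have hZ : ∀ t, Measurable fun ω => (obs L₁ L₂ f ε t ω, f t ω) := fun t =>
    (measurable_obs hmodel.measurable_f hmodel.measurable_ε t).prodMk (hmodel.measurable_f t)
  choose M hM using fun i => exists_moment_bound_obs (P := P) (L₁ := L₁) (L₂ := L₂)
    hmodel.measurable_f hmodel.measurable_ε (by linarith : 0 < 2 * γ) hC₁ hC₂ hmom_f hmom_ε i
  have hy : ∀ i, HasCoordMoments P (fun t ω => (obs L₁ L₂ f ε t ω, f t ω)) γ (M i)
      (fun t ω => obs L₁ L₂ f ε t ω i) := fun i =>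
    ⟨⟨fun z => z.1 i, (measurable_pi_apply i).comp measurable_fst, fun _ _ => rfl⟩,
      fun t => (hM i t).1, fun t => (hM i t).2⟩
  exact isBigOp_estimators_of_sampleAutocov P hr hv hp k₀ L₁ L₂ f ε hmodel hrank A₁ Q₁ A₂ Q₂ hL₁
    hA₁ hL₂ hA₂ B₁ B₂ hB₁ hB₁A₁ hB₂ hB₂A₂ A₁hat B₁hat B₂hat hG hB₂hat fun k =>
      isBigOp_sampleAutocov_sub hZ hγ hmix hy hmodel.mean_obs fun t i j =>
        hmodel.integral_obs_mul t k i j
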